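/- For non-zero polynomials $P_1,\dots,P_l\in\mathbb{C}[x]$ let $$m(P_1,\dots,P_l)=\frac{1}{2\pi i}\int_{|x|=1}\log|P_1(x)|\cdots\log|P_l(x)|\,\frac{dx}{x}$$ be their multiple Mahler measure. Let $\zeta$ be the Riemann zeta function, and for a Dirichlet character $\chi$ let $L(s,\chi)=\sum_{n\ge 1}\chi(n)n^{-s}$; let $\chi_{-3}$ and $\chi_{-4}$ be the nontrivial Dirichlet characters modulo $3$ and modulo $4$. 1. For all positive integers $a,b$ with $\gcd(a,b)=1$, $$m(x^a-1,x^b-1,x^b-1)=-\frac{2+a^3}{2a^2b}\,\zeta(3)+\frac{\pi}{2b}\sum_{\substack{h\ge 1\\ a\nmid h}}\frac{\cot(\pi h/a)}{h^2}.$$ 2. For every odd positive integer $d$, $$m(x-1,x^4-1,x^{2d}-1)=-\frac{9+d^3}{16d^2}\,\zeta(3)+\frac{\pi}{16}\sum_{\substack{h\ge 1\\ d\nmid 2h}}\frac{\cot\left(\pi\frac{2h}{d}\right)}{h^2}+\frac{\pi}{8}\sum_{\substack{h\ge 1\\ d\nmid h}}\frac{\cot\left(\pi\frac{(d+1)h}{2d}\right)}{h^2}.$$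 The integrals and the series in 1 and 2 converge absolutely. 3. In particular, for every positive integer $b$, $$m(x-1,x^b-1,x^b-1)=-\frac{3}{2b}\,\zeta(3);$$ for every positive integer $b$ coprime to $2$, $$m(x^2-1,x^b-1,x^b-1)=-\frac{5}{4b}\,\zeta(3);$$ for every positive integer $b$ coprime to $3$, $$m(x^3-1,x^b-1,x^b-1)=-\frac{29}{18b}\,\zeta(3)+\frac{\pi}{2\sqrt3\,b}\,L(2,\chi_{-3});$$ and for every positive integer $b$ coprime to $4$, $$m(x^4-1,x^b-1,x^b-1)=-\frac{33}{16b}\,\zeta(3)+\frac{\pi}{2b}\,L(2,\chi_{-4}).$$ -/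

import Mathlib

noncomputable section

/-- The multiple Mahler measure `m(P₁, …, P_l) = (1 / 2πi) ∮_{|x| = 1} ∏ log |P_j(x)| dx / x`,
written as the average of `∏ log |P_j(x)|` over the unit circle
(as Mathlib does for `Polynomial.logMahlerMeasure`). -/
def multipleMahlerMeasure {l : ℕ} (P : Fin l → Polynomial ℂ) : ℝ :=
  Real.circleAverage (fun x : ℂ => ∏ j, Real.log ‖(P j).eval x‖) 0 1

/-- The integral defining the multiple Mahler measure converges absolutely. -/
def MultipleMahlerIntegrable {l : ℕ} (P : Fin l → Polynomial ℂ) : Prop :=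
  CircleIntegrable (fun x : ℂ => ∏ j, Real.log ‖(P j).eval x‖) 0 1

/-- The quadratic Dirichlet character of discriminant `-3`, that is, the Legendre symbol modulo 3:
`1 ↦ 1`, `2 ↦ -1`, `0 ↦ 0`. -/
def chiNegThree : DirichletCharacter ℂ 3 :=
  (quadraticChar (ZMod 3)).ringHomComp (Int.castRingHom ℂ)

/-- The quadratic Dirichlet character of discriminant `-4`, that is, the nontrivial character
modulo 4: `1 ↦ 1`, `3 ↦ -1`, `0, 2 ↦ 0`. -/
def chiNegFour : DirichletCharacter ℂ 4 :=
  ZMod.χ₄.ringHomComp (Int.castRingHom ℂ)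

end

open Complex Set Filter Topology MeasureTheory

/-! On the circle, write log(1 − e^{2πit}) = L(t) − i S(t), with L = `logChord` and S = `sawtooth`.
The function log(1 − x^p) log(1 − x^q) log(1 − x^r) is holomorphic in the open disc and vanishes at
0, so its mean over the unit circle is 0. The real part of this identity expresses ∫ L(pt)L(qt)L(rt)
as the sum of the three integrals with one factor L and two factors S (`integral_logChord_mul_mul`).
The difficult triple product of logarithms is thus traded for a single logarithm against a bounded,
piecewise quadratic function g.

Since −L(pt) has the Fourier series ∑ cos(2πpnt)/n, each such integral equals −∑ c(pn)/n, where c is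
the cosine coefficient of g (`integral_logChord_mul`). For g(t) = S(t)S(at), cutting [0, 1] into a
equal pieces reduces c(h) to a sum over a-th roots of unity; its rational part produces ζ(3) and its
remaining part the cotangents (`cosCoeff_sawtooth_mul`).

Two reductions lead to this case. If gcd(a, b) = 1, averaging over translates by 1/b replaces g(bt)
by g(t) at the cost of a factor 1/b (`integral_logChord_mul_comp`). For the second formula, S(2t) =
S(t) + S(t + 1/2) handles the product S(2t)S(dt) (`cosCoeff_sawtooth_two_mul`). The L-values appear
because cot(πn/3) and cot(πn/4) are multiples of the characters. -/

/-- The point `exp (2 π i t)` of the unit circle. -/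
noncomputable def unitExp (t : ℝ) : ℂ := Complex.exp ((2 * Real.pi * t : ℝ) * I)

/-- The logarithm of the length of the chord from `1` to `exp (2 π i t)`. -/
noncomputable def logChord (t : ℝ) : ℝ := Real.log ‖1 - unitExp t‖

/-- The sawtooth function `-arg (1 - exp (2 π i t))`, equal to `π (1 / 2 - t)` on `(0, 1)`. -/
noncomputable def sawtooth (t : ℝ) : ℝ := -Complex.arg (1 - unitExp t)

/-! ### Boundary values of log(1 − x) on the unit circle -/

theorem unitExp_add (s t : ℝ) : unitExp (s + t) = unitExp s * unitExp t := by
  rw [unitExp, unitExp, unitExp, ← Complex.exp_add]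
  congr 1
  push_cast
  ring

theorem unitExp_nat_mul (n : ℕ) (t : ℝ) : unitExp (n * t) = unitExp t ^ n := by
  rw [unitExp, unitExp, ← Complex.exp_nat_mul]
  congr 1
  push_cast
  ring

theorem unitExp_one : unitExp 1 = 1 := by
  simp [unitExp]

theorem unitExp_natCast (n : ℕ) : unitExp n = 1 := by
  have := unitExp_nat_mul n 1
  rwa [mul_one, unitExp_one, one_pow] at this

theorem unitExp_half : unitExp (1 / 2) = -1 := by
  rw [unitExp, ← Complex.exp_pi_mul_I]
  congr 1
  push_cast
  ring

theorem unitExp_periodic : Function.Periodic unitExp 1 := fun t => by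
  rw [unitExp_add, unitExp_one, mul_one]

theorem norm_unitExp (t : ℝ) : ‖unitExp t‖ = 1 := Complex.norm_exp_ofReal_mul_I _

theorem continuous_unitExp : Continuous unitExp := by
  unfold unitExp
  fun_prop

theorem re_unitExp (t : ℝ) : (unitExp t).re = Real.cos (2 * Real.pi * t) :=
  Complex.exp_ofReal_mul_I_re _

theorem unitExp_eq_one_iff (t : ℝ) : unitExp t = 1 ↔ ∃ n : ℤ, t = n := by
  rw [unitExp, Complex.exp_eq_one_iff]
  have h : (2 * Real.pi * I : ℂ) ≠ 0 := Complex.two_pi_I_ne_zero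
  refine exists_congr fun n => ⟨fun hn => ?_, fun hn => ?_⟩
  · have : ((t : ℝ) : ℂ) * (2 * Real.pi * I) = n * (2 * Real.pi * I) := by
      rw [← hn]; push_cast; ring
    exact_mod_cast mul_right_cancel₀ h this
  · subst hn
    push_cast
    ring

theorem one_sub_unitExp (t : ℝ) :
    1 - unitExp t = ((2 * Real.sin (Real.pi * t) : ℝ) : ℂ) *
      (Complex.cos ((Real.pi * (t - 1 / 2) : ℝ) : ℂ)
        + Complex.sin ((Real.pi * (t - 1 / 2) : ℝ) : ℂ) * I) := by
  have h1 : unitExp t = Complex.exp ((Real.pi * t : ℝ) * I) ^ 2 := by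
    rw [unitExp, ← Complex.exp_nat_mul]
    congr 1
    push_cast
    ring
  have e : (Real.pi * (t - 1 / 2) : ℝ) = Real.pi * t - Real.pi / 2 := by ring
  rw [h1, e, ← Complex.ofReal_cos, ← Complex.ofReal_sin, Real.cos_sub_pi_div_two,
    Real.sin_sub_pi_div_two, Complex.exp_mul_I, ← Complex.ofReal_cos, ← Complex.ofReal_sin]
  have h2 : ((Real.cos (Real.pi * t) : ℝ) : ℂ) ^ 2 = 1 - ((Real.sin (Real.pi * t) : ℝ) : ℂ) ^ 2 := by
    have := Real.cos_sq' (Real.pi * t)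
    exact_mod_cast this
  push_cast at h2 ⊢
  linear_combination -h2 - (Complex.sin (Real.pi * t)) ^ 2 * Complex.I_sq

theorem sawtooth_of_mem_Ioo {t : ℝ} (ht : t ∈ Ioo (0 : ℝ) 1) :
    sawtooth t = Real.pi * (1 / 2 - t) := by
  have hpi := Real.pi_pos
  rw [sawtooth, one_sub_unitExp, Complex.arg_mul_cos_add_sin_mul_I]
  · ring
  · have := Real.sin_pos_of_pos_of_lt_pi (mul_pos hpi ht.1) (by nlinarith [ht.2])
    positivity
  · constructor <;> nlinarith [ht.1, ht.2]

theorem norm_one_sub_unitExp (t : ℝ) : ‖1 - unitExp t‖ = 2 * |Real.sin (Real.pi * t)| := by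
  rw [one_sub_unitExp, norm_mul, Complex.norm_real, Real.norm_eq_abs, abs_mul, abs_two,
    ← Complex.exp_mul_I, Complex.norm_exp_ofReal_mul_I, mul_one]

theorem sawtooth_periodic : Function.Periodic sawtooth 1 := fun t => by
  rw [sawtooth, unitExp_periodic t, sawtooth]

theorem logChord_periodic : Function.Periodic logChord 1 := fun t => by
  rw [logChord, unitExp_periodic t, logChord]

theorem measurable_sawtooth : Measurable sawtooth :=
  (Complex.measurable_arg.comp (measurable_const.sub continuous_unitExp.measurable)).neg

theorem measurable_logChord : Measurable logChord :=
  Real.measurable_log.comp (measurable_const.sub continuous_unitExp.measurable).norm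

theorem abs_sawtooth_le (t : ℝ) : |sawtooth t| ≤ Real.pi := by
  rw [sawtooth, abs_neg]
  exact Complex.abs_arg_le_pi _

theorem log_one_sub_unitExp (t : ℝ) :
    Complex.log (1 - unitExp t) = logChord t - sawtooth t * I := by
  apply Complex.ext <;> simp [logChord, sawtooth, Complex.log_re, Complex.log_im]

theorem one_sub_re_pos {z : ℂ} (hz : ‖z‖ ≤ 1) (hz1 : z ≠ 1) : 0 < (1 - z).re := by
  have h1 : z.re ≤ 1 := (Complex.re_le_norm z).trans hz
  rw [sub_re, one_re, sub_pos]
  refine lt_of_le_of_ne h1 fun h => hz1 ?_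
  have h2 : z.re * z.re + z.im * z.im ≤ 1 := by
    have := Complex.sq_norm z
    rw [Complex.normSq_apply] at this
    nlinarith [norm_nonneg z]
  rw [h] at h2
  exact Complex.ext h (show z.im = 0 by nlinarith)

/-- Both factors of (1 − z)(1 + z) lie in the right half-plane, so their arguments add without
wrapping. At z = ±1 one factor is 0 and the other is 2, and `arg 0 = 0` keeps the identity true, so
no exceptional points arise later. -/
theorem arg_one_sub_sq {z : ℂ} (hz : ‖z‖ = 1) :
    Complex.arg (1 - z ^ 2) = Complex.arg (1 - z) + Complex.arg (1 + z) := by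
  have h_two : Complex.arg 2 = 0 := by
    simp
  by_cases h1 : z = 1
  · subst h1
    norm_num [h_two]
  by_cases h2 : z = -1
  · subst h2
    norm_num [h_two]
  have r1 := one_sub_re_pos hz.le h1
  have r2 := one_sub_re_pos (z := -z) (by simpa using hz.le) fun h => h2 (by rw [← h, neg_neg])
  rw [sub_neg_eq_add] at r2
  have a1 := abs_lt.1 (Complex.abs_arg_lt_pi_div_two_iff.2 (Or.inl r1))
  have a2 := abs_lt.1 (Complex.abs_arg_lt_pi_div_two_iff.2 (Or.inl r2))
  rw [show 1 - z ^ 2 = (1 - z) * (1 + z) by ring]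
  refine Complex.arg_mul (fun h => by simp [h] at r1) (fun h => by simp [h] at r2) ⟨?_, ?_⟩ <;>
    linarith [a1.1, a1.2, a2.1, a2.2]

theorem sawtooth_two_mul (t : ℝ) : sawtooth (2 * t) = sawtooth t + sawtooth (t + 1 / 2) := by
  have h := arg_one_sub_sq (norm_unitExp t)
  have h2 := unitExp_nat_mul 2 t
  push_cast at h2
  rw [sawtooth, sawtooth, sawtooth, h2, unitExp_add, unitExp_half, mul_neg_one, sub_neg_eq_add]
  linarith

/-! ### Integrability of the cubed logarithm -/

/-- This is log y ≤ y − 1 at y = x and y = x^(−1/6). The exponent 1/6 is chosen so that the cube is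
of order x^(−1/2), which is integrable at 0. -/
theorem abs_log_le_rpow {x : ℝ} (h0 : 0 < x) (h2 : x ≤ 2) :
    |Real.log x| ≤ 2 + 6 * x ^ (-(1 / 6) : ℝ) := by
  have hp : 0 < x ^ (-(1 / 6) : ℝ) := Real.rpow_pos_of_pos h0 _
  have h3 := Real.log_le_sub_one_of_pos h0
  have h4 := Real.log_le_sub_one_of_pos hp
  rw [Real.log_rpow h0] at h4
  rw [abs_le]
  constructor <;> linarith

theorem intervalIntegrable_logChord_add_cube :
    IntervalIntegrable (fun t => (|logChord t| + 5) ^ 3) volume 0 1 := by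
  have hr : IntervalIntegrable (fun t : ℝ => t ^ (-(1 / 2) : ℝ)) volume 0 1 :=
    intervalIntegral.intervalIntegrable_rpow' (by norm_num)
  have hr' : IntervalIntegrable (fun t : ℝ => (1 - t) ^ (-(1 / 2) : ℝ)) volume 0 1 := by
    simpa using (hr.comp_sub_left 1).symm
  have hb : IntervalIntegrable (fun t : ℝ => 4 * (343 + 216 * (t ^ (-(1 / 2) : ℝ)
      + (1 - t) ^ (-(1 / 2) : ℝ)))) volume 0 1 :=
    ((_root_.intervalIntegrable_const (c := (343 : ℝ))).add
      ((hr.add hr').const_mul 216)).const_mul 4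
  refine hb.mono_fun' ?_ ?_
  · exact ((measurable_logChord.norm.add_const 5).pow_const 3).aestronglyMeasurable
  · have hne : ∀ᵐ t : ℝ ∂volume.restrict (uIoc 0 1), t ≠ 1 :=
      ae_restrict_of_ae (Measure.ae_ne volume 1)
    filter_upwards [ae_restrict_mem measurableSet_uIoc, hne] with t ht ht1
    rw [uIoc_of_le zero_le_one] at ht
    have t0 : 0 < t := ht.1
    have t1 : t < 1 := lt_of_le_of_ne ht.2 ht1
    have hpi := Real.pi_pos
    have hsin : 2 * min t (1 - t) ≤ Real.sin (Real.pi * t) := by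
      rcases le_total t (1 / 2) with h | h
      · have := Real.mul_le_sin (x := Real.pi * t) (by positivity) (by nlinarith)
        calc 2 * min t (1 - t) ≤ 2 * t := by gcongr; exact min_le_left _ _
          _ = 2 / Real.pi * (Real.pi * t) := by field_simp
          _ ≤ _ := this
      · have := Real.mul_le_sin (x := Real.pi * (1 - t)) (by nlinarith) (by nlinarith)
        calc 2 * min t (1 - t) ≤ 2 * (1 - t) := by gcongr; exact min_le_right _ _
          _ = 2 / Real.pi * (Real.pi * (1 - t)) := by field_simp
          _ ≤ _ := this
          _ = Real.sin (Real.pi * t) := by rw [mul_sub, mul_one, Real.sin_pi_sub]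
    have hm : 0 < min t (1 - t) := lt_min t0 (by linarith)
    set x := ‖1 - unitExp t‖ with hx
    have hxs : x = 2 * Real.sin (Real.pi * t) := by
      rw [hx, norm_one_sub_unitExp, abs_of_pos (by linarith)]
    have hx0 : 0 < x := by rw [hxs]; linarith
    have hx2 : x ≤ 2 := by rw [hxs]; linarith [Real.sin_le_one (Real.pi * t)]
    have hy := abs_log_le_rpow hx0 hx2
    have hyp : 0 < x ^ (-(1 / 6) : ℝ) := Real.rpow_pos_of_pos hx0 _
    have hy3 : (x ^ (-(1 / 6) : ℝ)) ^ 3 = x ^ (-(1 / 2) : ℝ) := by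
      rw [← Real.rpow_natCast, ← Real.rpow_mul hx0.le]
      norm_num
    have hxm : x ^ (-(1 / 2) : ℝ) ≤ t ^ (-(1 / 2) : ℝ) + (1 - t) ^ (-(1 / 2) : ℝ) := by
      have h1 : x ^ (-(1 / 2) : ℝ) ≤ (min t (1 - t)) ^ (-(1 / 2) : ℝ) :=
        Real.rpow_le_rpow_of_nonpos hm (by linarith) (by norm_num)
      have p1 : 0 < t ^ (-(1 / 2) : ℝ) := Real.rpow_pos_of_pos t0 _
      have p2 : 0 < (1 - t) ^ (-(1 / 2) : ℝ) := Real.rpow_pos_of_pos (by linarith) _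
      rcases min_choice t (1 - t) with h | h <;> rw [h] at h1 <;> linarith
    rw [Real.norm_of_nonneg (by positivity)]
    set y := x ^ (-(1 / 6) : ℝ)
    -- Here 7 = 2 + 5. The next bound is the convexity inequality (u + v)³ ≤ 4(u³ + v³), whose
    -- defect is 3(u + v)(u − v)².
    calc (|logChord t| + 5) ^ 3 ≤ (7 + 6 * y) ^ 3 := by
          have : |logChord t| ≤ 2 + 6 * y := hy
          exact pow_le_pow_left₀ (by positivity) (by linarith) 3
      _ ≤ 4 * (343 + 216 * y ^ 3) := by
          nlinarith [mul_nonneg (add_nonneg (by norm_num : (0 : ℝ) ≤ 7) (mul_pos (by norm_num : (0 : ℝ) < 6) hyp).le)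
            (sq_nonneg (7 - 6 * y))]
      _ ≤ _ := by rw [hy3]; gcongr

/-! ### Rescaling, subdivision of [0, 1], and circle averages -/

theorem Function.Periodic.intervalIntegrable_comp_nat_mul {E : Type*} [NormedAddCommGroup E]
    {f : ℝ → E} (hf : Function.Periodic f 1) (hi : IntervalIntegrable f volume 0 1)
    {n : ℕ} (hn : 0 < n) : IntervalIntegrable (fun t => f (n * t)) volume 0 1 := by
  have hn0 : (n : ℝ) ≠ 0 := by positivity
  have h := hf.intervalIntegrable one_ne_zero (t := 0) (by simpa using hi) 0 n
  simpa [hn0] using h.comp_mul_left (c := (n : ℝ))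

theorem integral_zero_one_eq_sum {E : Type*} [NormedAddCommGroup E] [NormedSpace ℝ E]
    {f : ℝ → E} (hi : IntervalIntegrable f volume 0 1) {n : ℕ} (hn : 0 < n) :
    ∫ t in (0 : ℝ)..1, f t =
      (n : ℝ)⁻¹ • ∑ j ∈ Finset.range n, ∫ s in (0 : ℝ)..1, f ((j + s) / n) := by
  have hn0 : (n : ℝ) ≠ 0 := by positivity
  have h1 : ∀ j : ℕ, ∫ s in (0 : ℝ)..1, f ((j + s) / n) =
      (n : ℝ) • ∫ t in ((j : ℝ) / n)..((j + 1 : ℕ) : ℝ) / n, f t := by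
    intro j
    have := intervalIntegral.integral_comp_add_div f hn0 ((j : ℝ) / n) (a := 0) (b := 1)
    simp only [← add_div] at this
    rw [this]
    simp [add_div]
  simp_rw [h1]
  rw [← Finset.smul_sum, inv_smul_smul₀ hn0,
    intervalIntegral.sum_integral_adjacent_intervals (a := fun j : ℕ => (j : ℝ) / n)]
  · simp [hn0]
  · intro k hk
    refine hi.mono_set ?_
    rw [uIcc_of_le zero_le_one, uIcc_of_le (by gcongr; exact Nat.le_succ k)]
    refine Icc_subset_Icc (by positivity) ?_
    rw [div_le_one (by positivity)]
    exact_mod_cast hk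

theorem circleAverage_eq_integral_unitExp {E : Type*} [NormedAddCommGroup E] [NormedSpace ℝ E]
    (f : ℂ → E) (r : ℝ) :
    Real.circleAverage f 0 r = ∫ t in (0 : ℝ)..1, f (r * unitExp t) := by
  have h := intervalIntegral.integral_comp_mul_left (a := 0) (b := 1)
    (fun θ => f (circleMap 0 r θ)) Real.two_pi_pos.ne'
  rw [mul_zero, mul_one] at h
  rw [Real.circleAverage, ← h]
  simp [circleMap, unitExp]

theorem circleIntegrable_of_comp_unitExp {E : Type*} [NormedAddCommGroup E] {f : ℂ → E}
    (h : IntervalIntegrable (fun t => f (unitExp t)) volume 0 1) : CircleIntegrable f 0 1 := by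
  have hpi := Real.pi_ne_zero
  have h1 := h.comp_mul_left (c := (2 * Real.pi)⁻¹)
  have h2 : ∀ x : ℝ, unitExp ((2 * Real.pi)⁻¹ * x) = circleMap 0 1 x := by
    intro x
    rw [unitExp, mul_inv_cancel_left₀ Real.two_pi_pos.ne']
    simp [circleMap]
  simp_rw [h2] at h1
  simpa [CircleIntegrable] using h1

theorem ae_unitExp_nat_mul_ne_one {n : ℕ} (hn : 0 < n) : ∀ᵐ t : ℝ, unitExp (n * t) ≠ 1 := by
  have hn0 : (n : ℝ) ≠ 0 := by positivity
  have hc : (range fun m : ℤ => (m : ℝ) / n).Countable := countable_range _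
  filter_upwards [hc.ae_notMem volume] with t ht h
  obtain ⟨m, hm⟩ := (unitExp_eq_one_iff _).1 h
  exact ht ⟨m, by simp only [← hm]; field_simp⟩

/-! ### Vanishing of the mean of a product of three logarithms -/

theorem mul_mul_le_add_pow_three {a b c : ℝ} (ha : 0 ≤ a) (hb : 0 ≤ b) (hc : 0 ≤ c) :
    a * b * c ≤ a ^ 3 + b ^ 3 + c ^ 3 := by
  nlinarith [mul_nonneg (add_nonneg (add_nonneg ha hb) hc)
    (add_nonneg (add_nonneg (sq_nonneg (a - b)) (sq_nonneg (b - c))) (sq_nonneg (a - c))),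
    mul_nonneg (mul_nonneg ha hb) hc]

/-- A majorant for the modulus of the boundary values of a product of three logarithms. -/
noncomputable def logMajorant (p q r : ℕ) (t : ℝ) : ℝ :=
  (|logChord (p * t)| + 5) * (|logChord (q * t)| + 5) * (|logChord (r * t)| + 5)

theorem measurable_logChord_mul (p : ℕ) : Measurable fun t => logChord (p * t) :=
  measurable_logChord.comp (measurable_const_mul _)

theorem measurable_sawtooth_mul (p : ℕ) : Measurable fun t => sawtooth (p * t) :=
  measurable_sawtooth.comp (measurable_const_mul _)

theorem measurable_logMajorant (p q r : ℕ) : Measurable (logMajorant p q r) :=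
  (((measurable_logChord_mul p).norm.add_const 5).mul
    ((measurable_logChord_mul q).norm.add_const 5)).mul
    ((measurable_logChord_mul r).norm.add_const 5)

theorem logMajorant_nonneg (p q r : ℕ) (t : ℝ) : 0 ≤ logMajorant p q r t := by
  unfold logMajorant
  positivity

theorem intervalIntegrable_logMajorant {p q r : ℕ} (hp : 0 < p) (hq : 0 < q) (hr : 0 < r) :
    IntervalIntegrable (logMajorant p q r) volume 0 1 := by
  have hper : Function.Periodic (fun t => (|logChord t| + 5) ^ 3) 1 := fun t => by
    simp only [logChord_periodic t]
  have h := fun {n : ℕ} (hn : 0 < n) =>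
    hper.intervalIntegrable_comp_nat_mul intervalIntegrable_logChord_add_cube hn
  refine (((h hp).add (h hq)).add (h hr)).mono_fun'
    (measurable_logMajorant p q r).aestronglyMeasurable (ae_of_all _ fun t => ?_)
  refine (Real.norm_of_nonneg (logMajorant_nonneg p q r t)).trans_le ?_
  exact mul_mul_le_add_pow_three (by positivity) (by positivity) (by positivity)

theorem intervalIntegrable_of_le_logMajorant {E : Type*} [NormedAddCommGroup E] {f : ℝ → E}
    {p q r : ℕ} (hp : 0 < p) (hq : 0 < q) (hr : 0 < r)
    (hm : AEStronglyMeasurable f volume) (hf : ∀ t, ‖f t‖ ≤ logMajorant p q r t) :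
    IntervalIntegrable f volume 0 1 :=
  (intervalIntegrable_logMajorant hp hq hr).mono_fun' hm.restrict (ae_of_all _ hf)

/-- Since 1 − s ≤ |1 − sz|, moving radially inward at most halves the distance to 1. The real part
therefore costs an extra log 2 and the imaginary part at most π, and log 2 + π < 5. The bound is
uniform in s, as dominated convergence requires. -/
theorem norm_log_one_sub_mul_le {z : ℂ} (hz : ‖z‖ = 1) (hz1 : z ≠ 1) {s : ℝ}
    (hs0 : 0 ≤ s) (hs1 : s ≤ 1) :
    ‖Complex.log (1 - s * z)‖ ≤ |Real.log ‖1 - z‖| + 5 := by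
  have hsz : ‖(s : ℂ) * z‖ = s := by simp [hz, abs_of_nonneg hs0]
  have h0 : 0 < ‖1 - z‖ := norm_pos_iff.2 (sub_ne_zero.2 hz1.symm)
  have hlow : ‖1 - z‖ ≤ 2 * ‖1 - s * z‖ := by
    have h1 : ‖1 - z‖ ≤ ‖1 - s * z‖ + (1 - s) := by
      have : (1 - z) = (1 - s * z) - ((1 - s : ℝ) : ℂ) * z := by push_cast; ring
      rw [this]
      refine (norm_sub_le _ _).trans (le_of_eq ?_)
      rw [norm_mul, hz, Complex.norm_real, Real.norm_of_nonneg (by linarith), mul_one]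
    have h2 : 1 - s ≤ ‖1 - s * z‖ := by
      have := norm_sub_norm_le (1 : ℂ) (s * z)
      rwa [hsz, norm_one] at this
    linarith
  have hup : ‖1 - s * z‖ ≤ 2 := by
    refine (norm_sub_le _ _).trans ?_
    rw [hsz, norm_one]
    linarith
  have hpos : 0 < ‖1 - s * z‖ := by linarith
  have l1 := Real.log_le_log h0 hlow
  rw [Real.log_mul two_ne_zero hpos.ne'] at l1
  have l2 := Real.log_le_log hpos hup
  have l3 := Real.log_two_lt_d9
  have l4 : |Real.log ‖1 - s * z‖| ≤ |Real.log ‖1 - z‖| + Real.log 2 := by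
    rw [abs_le]
    constructor
    · linarith [neg_abs_le (Real.log ‖1 - z‖)]
    · linarith [abs_nonneg (Real.log ‖1 - z‖)]
  have l5 := Complex.norm_le_abs_re_add_abs_im (Complex.log (1 - s * z))
  rw [Complex.log_re, Complex.log_im] at l5
  have l6 := Complex.abs_arg_le_pi (1 - s * z)
  linarith [Real.pi_lt_d2]

theorem continuousAt_log_one_sub {z : ℂ} (hz : ‖z‖ ≤ 1) (hz1 : z ≠ 1) :
    ContinuousAt (fun w => Complex.log (1 - w)) z :=
  (continuousAt_const.sub continuousAt_id).clog (Or.inl (one_sub_re_pos hz hz1))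

/-- The mean value property holds on each circle of radius s < 1; the majorant lets s tend to 1. -/
theorem integral_log_mul_log_mul_log {p q r : ℕ} (hp : 0 < p) (hq : 0 < q) (hr : 0 < r) :
    ∫ t in (0 : ℝ)..1, Complex.log (1 - unitExp (p * t)) * Complex.log (1 - unitExp (q * t))
      * Complex.log (1 - unitExp (r * t)) = 0 := by
  let F : ℂ → ℂ := fun z =>
    Complex.log (1 - z ^ p) * Complex.log (1 - z ^ q) * Complex.log (1 - z ^ r)
  have hF : ∀ s : ℝ, 0 < s → s < 1 → ∫ t in (0 : ℝ)..1, F (s * unitExp t) = 0 := by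
    intro s hs0 hs1
    rw [← circleAverage_eq_integral_unitExp]
    have hd : ∀ {n : ℕ}, 0 < n → DifferentiableOn ℂ (fun z : ℂ => Complex.log (1 - z ^ n))
        (Metric.ball 0 1) := by
      intro n hn z hz
      have hz1 : ‖z ^ n‖ < 1 := by
        rw [norm_pow]
        exact pow_lt_one₀ (norm_nonneg _) (by simpa using hz) hn.ne'
      refine ((differentiableAt_id.pow n).const_sub 1).clog ?_ |>.differentiableWithinAt
      exact Or.inl (one_sub_re_pos hz1.le fun h => by simp [h] at hz1)
    have hFd : DifferentiableOn ℂ F (Metric.ball 0 1) := ((hd hp).mul (hd hq)).mul (hd hr)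
    have hcl : closure (Metric.ball (0 : ℂ) |s|) ⊆ Metric.ball 0 1 := by
      refine Metric.closure_ball_subset_closedBall.trans (Metric.closedBall_subset_ball ?_)
      rwa [abs_of_pos hs0]
    -- The average is F(0), which is 0 because log(1 − 0^p) = 0 for p > 0.
    rw [(hFd.mono hcl).diffContOnCl.circleAverage]
    simp [F, hp.ne']
  have hlim : Tendsto (fun s : ℝ => ∫ t in (0 : ℝ)..1, F (s * unitExp t)) (𝓝[<] 1)
      (𝓝 (∫ t in (0 : ℝ)..1, F (unitExp t))) := by
    have hmem : Ioo (0 : ℝ) 1 ∈ 𝓝[<] (1 : ℝ) := Ioo_mem_nhdsLT one_pos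
    have hmeas : Measurable F := by
      have hm : ∀ n : ℕ, Measurable fun z : ℂ => Complex.log (1 - z ^ n) := fun n =>
        Complex.measurable_log.comp (measurable_const.sub (measurable_id.pow_const n))
      exact ((hm p).mul (hm q)).mul (hm r)
    refine intervalIntegral.tendsto_integral_filter_of_dominated_convergence (logMajorant p q r)
      (Eventually.of_forall fun s => ?_) ?_ (intervalIntegrable_logMajorant hp hq hr) ?_
    · exact (hmeas.comp (continuous_unitExp.measurable.const_mul _)).aestronglyMeasurable
    · filter_upwards [hmem] with s hs
      filter_upwards [ae_unitExp_nat_mul_ne_one hp, ae_unitExp_nat_mul_ne_one hq,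
        ae_unitExp_nat_mul_ne_one hr] with t h1 h2 h3 _
      have hb : ∀ n : ℕ, unitExp (n * t) ≠ 1 →
          ‖Complex.log (1 - (s * unitExp t) ^ n)‖ ≤ |logChord (n * t)| + 5 := by
        intro n hn
        have := norm_log_one_sub_mul_le (norm_unitExp _) hn (pow_nonneg hs.1.le n)
          (pow_le_one₀ hs.1.le hs.2.le)
        rwa [unitExp_nat_mul, ofReal_pow, ← mul_pow, ← unitExp_nat_mul] at this
      simp only [F, norm_mul, logMajorant]
      gcongr
      exacts [hb p h1, hb q h2, hb r h3]
    · filter_upwards [ae_unitExp_nat_mul_ne_one hp, ae_unitExp_nat_mul_ne_one hq,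
        ae_unitExp_nat_mul_ne_one hr] with t h1 h2 h3 _
      have hs : Tendsto (fun s : ℝ => (s : ℂ) * unitExp t) (𝓝[<] 1) (𝓝 (unitExp t)) := by
        have : Continuous fun s : ℝ => (s : ℂ) * unitExp t := by fun_prop
        simpa using (this.tendsto 1).mono_left nhdsWithin_le_nhds
      have hc : ∀ n : ℕ, unitExp (n * t) ≠ 1 →
          Tendsto (fun s : ℝ => Complex.log (1 - (s * unitExp t) ^ n)) (𝓝[<] 1)
            (𝓝 (Complex.log (1 - unitExp t ^ n))) := by
        intro n hn
        rw [unitExp_nat_mul] at hn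
        exact (continuousAt_log_one_sub (by simp [norm_unitExp]) hn).tendsto.comp (hs.pow n)
      exact ((hc p h1).mul (hc q h2)).mul (hc r h3)
  have hz : Tendsto (fun s : ℝ => ∫ t in (0 : ℝ)..1, F (s * unitExp t)) (𝓝[<] 1) (𝓝 0) := by
    refine tendsto_const_nhds.congr' ?_
    filter_upwards [Ioo_mem_nhdsLT (zero_lt_one (α := ℝ))] with s hs
    exact (hF s hs.1 hs.2).symm
  have := tendsto_nhds_unique hlim hz
  simpa only [F, ← unitExp_nat_mul] using this

theorem intervalIntegrable_logChord_mul {p : ℕ} (hp : 0 < p) {g : ℝ → ℝ} (hg : Measurable g)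
    {C : ℝ} (hC : ∀ t, |g t| ≤ C) :
    IntervalIntegrable (fun t => logChord (p * t) * g t) volume 0 1 := by
  refine ((intervalIntegrable_logMajorant hp hp hp).mul_const C).mono_fun'
    ((measurable_logChord_mul p).mul hg).aestronglyMeasurable (ae_of_all _ fun t => ?_)
  refine (norm_mul _ _).trans_le ?_
  refine mul_le_mul ?_ (hC t) (abs_nonneg _) (logMajorant_nonneg _ _ _ _)
  -- Each factor of the majorant is at least 5, so the product of three dominates a single
  -- logarithm.
  have h := abs_nonneg (logChord (p * t))
  rw [Real.norm_eq_abs, logMajorant]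
  nlinarith [mul_nonneg h h, mul_nonneg (mul_nonneg h h) h]

theorem intervalIntegrable_logChord_mul_mul {p q r : ℕ} (hp : 0 < p) (hq : 0 < q) (hr : 0 < r) :
    IntervalIntegrable (fun t => logChord (p * t) * logChord (q * t) * logChord (r * t))
      volume 0 1 := by
  refine intervalIntegrable_of_le_logMajorant hp hq hr (((measurable_logChord_mul p).mul
    (measurable_logChord_mul q)).mul (measurable_logChord_mul r)).aestronglyMeasurable fun t => ?_
  rw [norm_mul, norm_mul, Real.norm_eq_abs, Real.norm_eq_abs, Real.norm_eq_abs, logMajorant]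
  gcongr <;> linarith

theorem abs_sawtooth_mul_sawtooth_le (p q : ℕ) (t : ℝ) :
    |sawtooth (p * t) * sawtooth (q * t)| ≤ Real.pi * Real.pi := by
  rw [abs_mul]
  exact mul_le_mul (abs_sawtooth_le _) (abs_sawtooth_le _) (abs_nonneg _) Real.pi_pos.le

theorem measurable_sawtooth_mul_sawtooth (p q : ℕ) :
    Measurable fun t => sawtooth (p * t) * sawtooth (q * t) :=
  (measurable_sawtooth_mul p).mul (measurable_sawtooth_mul q)

/-- Real part of the vanishing integral: of the terms of ∏ (L − iS), those with exactly two factors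
S carry (−i)² = −1, and those with one or three are imaginary. -/
theorem integral_logChord_mul_mul {p q r : ℕ} (hp : 0 < p) (hq : 0 < q) (hr : 0 < r) :
    ∫ t in (0 : ℝ)..1, logChord (p * t) * logChord (q * t) * logChord (r * t) =
      (∫ t in (0 : ℝ)..1, logChord (p * t) * (sawtooth (q * t) * sawtooth (r * t)))
      + (∫ t in (0 : ℝ)..1, logChord (q * t) * (sawtooth (p * t) * sawtooth (r * t)))
      + ∫ t in (0 : ℝ)..1, logChord (r * t) * (sawtooth (p * t) * sawtooth (q * t)) := by
  have hi := fun {a : ℕ} (b c : ℕ) (ha : 0 < a) => intervalIntegrable_logChord_mul ha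
    (measurable_sawtooth_mul_sawtooth b c)
    (abs_sawtooth_mul_sawtooth_le b c)
  have hre := congrArg Complex.re (integral_log_mul_log_mul_log hp hq hr)
  have hint : IntervalIntegrable (fun t : ℝ => Complex.log (1 - unitExp (p * t))
      * Complex.log (1 - unitExp (q * t)) * Complex.log (1 - unitExp (r * t))) volume 0 1 := by
    have hm : ∀ n : ℕ, Measurable fun t : ℝ => Complex.log (1 - unitExp (n * t)) := fun n =>
      Complex.measurable_log.comp (measurable_const.sub
        (continuous_unitExp.measurable.comp (measurable_const_mul _)))
    refine intervalIntegrable_of_le_logMajorant hp hq hr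
      (((hm p).mul (hm q)).mul (hm r)).aestronglyMeasurable fun t => ?_
    have hb : ∀ n : ℕ, ‖Complex.log (1 - unitExp (n * t))‖ ≤ |logChord (n * t)| + 5 := by
      intro n
      have h := Complex.norm_le_abs_re_add_abs_im (Complex.log (1 - unitExp (n * t)))
      rw [log_one_sub_unitExp] at h ⊢
      simp at h
      linarith [abs_sawtooth_le (n * t), Real.pi_lt_d2]
    rw [norm_mul, norm_mul, logMajorant]
    gcongr <;> exact hb _
  have hre' : ∫ t in (0 : ℝ)..1, (logChord (p * t) * logChord (q * t) * logChord (r * t)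
      - logChord (p * t) * (sawtooth (q * t) * sawtooth (r * t))
      - logChord (q * t) * (sawtooth (p * t) * sawtooth (r * t))
      - logChord (r * t) * (sawtooth (p * t) * sawtooth (q * t))) = 0 := by
    have e := intervalIntegral.intervalIntegral_re hint
    refine Eq.trans (intervalIntegral.integral_congr fun t _ => ?_) (e.trans hre)
    simp only [log_one_sub_unitExp, RCLike.re_to_complex]
    simp
    ring
  rw [intervalIntegral.integral_sub (((intervalIntegrable_logChord_mul_mul hp hq hr).sub
      (hi q r hp)).sub (hi p r hq)) (hi p q hr),
    intervalIntegral.integral_sub ((intervalIntegrable_logChord_mul_mul hp hq hr).sub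
      (hi q r hp)) (hi p r hq),
    intervalIntegral.integral_sub (intervalIntegrable_logChord_mul_mul hp hq hr)
      (hi q r hp)] at hre'
  linarith

/-! ### Pairing a logarithm with a bounded function -/

/-- The cosine Fourier coefficient `∫₀¹ cos (2 π h t) g t dt`. -/
noncomputable def cosCoeff (g : ℝ → ℝ) (h : ℕ) : ℝ :=
  ∫ t in (0 : ℝ)..1, Real.cos (2 * Real.pi * (h * t)) * g t

theorem intervalIntegrable_cos_mul {g : ℝ → ℝ} (hg : Measurable g) {C : ℝ}
    (hC : ∀ t, |g t| ≤ C) (h : ℕ) :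
    IntervalIntegrable (fun t => Real.cos (2 * Real.pi * (h * t)) * g t) volume 0 1 := by
  refine (_root_.intervalIntegrable_const (c := C)).mono_fun'
    (Measurable.aestronglyMeasurable (by fun_prop)) (ae_of_all _ fun t => ?_)
  refine (norm_mul _ _).trans_le ?_
  calc _ ≤ 1 * C := mul_le_mul (Real.abs_cos_le_one _) (hC t) (abs_nonneg _) zero_le_one
    _ = C := one_mul C

/-- Inside the disc the Taylor series of −log(1 − z) converges geometrically, so it may be
integrated term by term. The term n = 0 is 0 by division by zero. -/
theorem hasSum_integral_log_one_sub_mul {p : ℕ} {g : ℝ → ℝ} (hg : Measurable g)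
    {C : ℝ} (hC : ∀ t, |g t| ≤ C) {s : ℝ} (hs0 : 0 < s) (hs1 : s < 1) :
    HasSum (fun n : ℕ => s ^ n * (cosCoeff g (p * n) / n))
      (∫ t in (0 : ℝ)..1, -(Complex.log (1 - s * unitExp (p * t))).re * g t) := by
  have hC0 : 0 ≤ C := (abs_nonneg _).trans (hC 0)
  have key : ∀ t : ℝ, HasSum
      (fun n : ℕ => s ^ n / n * (Real.cos (2 * Real.pi * ((p * n : ℕ) * t)) * g t))
      (-(Complex.log (1 - s * unitExp (p * t))).re * g t) := by
    intro t
    have h := Complex.hasSum_re (Complex.hasSum_taylorSeries_neg_log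
      (z := s * unitExp (p * t)) (by simpa [norm_unitExp, abs_of_pos hs0] using hs1))
    rw [Complex.neg_re] at h
    refine (congrArg (fun f => HasSum f _) (funext fun n => ?_)).mpr (h.mul_right (g t))
    rw [← mul_assoc]
    congr 1
    rw [mul_pow, unitExp_nat_mul, ← pow_mul, ← unitExp_nat_mul, mul_div_right_comm,
      ← Complex.ofReal_pow, ← Complex.ofReal_natCast, ← Complex.ofReal_div, Complex.re_ofReal_mul,
      re_unitExp]
  have hb : ∀ n : ℕ, s ^ n / n ≤ s ^ n := by
    intro n
    rcases n.eq_zero_or_pos with rfl | hn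
    · simp
    · exact div_le_self (by positivity) (by exact_mod_cast hn)
  have h := intervalIntegral.hasSum_integral_of_dominated_convergence (a := 0) (b := 1)
    (μ := volume) (fun (n : ℕ) _ => s ^ n * C)
    (F := fun n t => s ^ n / n * (Real.cos (2 * Real.pi * ((p * n : ℕ) * t)) * g t))
    (fun n => Measurable.aestronglyMeasurable (by fun_prop))
    (fun n => ae_of_all _ fun t _ => by
      rw [norm_mul, norm_mul, Real.norm_of_nonneg (by positivity : 0 ≤ s ^ n / n)]
      refine mul_le_mul (hb n) ?_ (by positivity) (by positivity)
      calc _ ≤ 1 * C := mul_le_mul (Real.abs_cos_le_one _) (hC t) (abs_nonneg _) zero_le_one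
        _ = C := one_mul C)
    (ae_of_all _ fun t _ => (summable_geometric_of_lt_one hs0.le hs1).mul_right C)
    (_root_.intervalIntegrable_const)
    (ae_of_all _ fun t _ => key t)
  refine (congrArg (fun f => HasSum f _) (funext fun n => ?_)).mpr h
  rw [intervalIntegral.integral_const_mul, cosCoeff]
  ring

/-- Abel summation: the disc identity is taken to the limit s → 1, the series being dominated by its
absolutely summable limit and the integral by `logMajorant`. -/
theorem integral_logChord_mul {p : ℕ} (hp : 0 < p) {g : ℝ → ℝ} (hg : Measurable g)
    {C : ℝ} (hC : ∀ t, |g t| ≤ C) (hs : Summable fun n : ℕ => cosCoeff g (p * n) / n) :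
    ∫ t in (0 : ℝ)..1, logChord (p * t) * g t = -∑' n : ℕ, cosCoeff g (p * n) / n := by
  have hC0 : 0 ≤ C := (abs_nonneg _).trans (hC 0)
  have hmem : Ioo (0 : ℝ) 1 ∈ 𝓝[<] (1 : ℝ) := Ioo_mem_nhdsLT one_pos
  have h1 : Tendsto (fun s : ℝ => ∑' n : ℕ, s ^ n * (cosCoeff g (p * n) / n)) (𝓝[<] 1)
      (𝓝 (∑' n : ℕ, cosCoeff g (p * n) / n)) := by
    refine tendsto_tsum_of_dominated_convergence hs.norm (fun n => ?_) ?_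
    · have : Continuous fun s : ℝ => s ^ n * (cosCoeff g (p * n) / n) := by fun_prop
      simpa using (this.tendsto 1).mono_left nhdsWithin_le_nhds
    · filter_upwards [hmem] with s hs n
      rw [norm_mul, Real.norm_of_nonneg (pow_nonneg hs.1.le n)]
      exact mul_le_of_le_one_left (norm_nonneg _) (pow_le_one₀ hs.1.le hs.2.le)
  have h2 : Tendsto
      (fun s : ℝ => ∫ t in (0 : ℝ)..1, -(Complex.log (1 - s * unitExp (p * t))).re * g t)
      (𝓝[<] 1) (𝓝 (∫ t in (0 : ℝ)..1, -logChord (p * t) * g t)) := by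
    refine intervalIntegral.tendsto_integral_filter_of_dominated_convergence
      (fun t => logMajorant p p p t * C)
      (Eventually.of_forall fun s => ?_) ?_
      ((intervalIntegrable_logMajorant hp hp hp).mul_const C) ?_
    · have : Measurable fun t : ℝ => Complex.log (1 - s * unitExp (p * t)) :=
        Complex.measurable_log.comp (measurable_const.sub ((continuous_unitExp.measurable.comp
          (measurable_const_mul _)).const_mul _))
      exact ((Complex.measurable_re.comp this).neg.mul hg).aestronglyMeasurable
    · filter_upwards [hmem] with s hs
      filter_upwards [ae_unitExp_nat_mul_ne_one hp] with t ht _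
      rw [norm_mul, norm_neg]
      refine mul_le_mul ?_ (hC t) (abs_nonneg _) (logMajorant_nonneg _ _ _ _)
      refine (Complex.abs_re_le_norm _).trans
        ((norm_log_one_sub_mul_le (norm_unitExp _) ht hs.1.le hs.2.le).trans ?_)
      have h := abs_nonneg (logChord (p * t))
      change |logChord (p * t)| + 5 ≤ _
      rw [logMajorant]
      nlinarith [mul_nonneg h h, mul_nonneg (mul_nonneg h h) h]
    · filter_upwards [ae_unitExp_nat_mul_ne_one hp] with t ht _
      have h : Tendsto (fun s : ℝ => (s : ℂ) * unitExp (p * t)) (𝓝[<] 1)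
          (𝓝 (unitExp (p * t))) := by
        have : Continuous fun s : ℝ => (s : ℂ) * unitExp (p * t) := by fun_prop
        simpa using (this.tendsto 1).mono_left nhdsWithin_le_nhds
      have h' := (continuousAt_log_one_sub (norm_unitExp _).le ht).tendsto.comp h
      have h'' := ((Complex.continuous_re.tendsto _).comp h').neg.mul_const (g t)
      rwa [Complex.log_re] at h''
  have h3 := tendsto_nhds_unique (h1.congr' ?_) h2
  · rw [h3]
    simp
  · filter_upwards [hmem] with s hs
    exact (hasSum_integral_log_one_sub_mul hg hC hs.1 hs.2).tsum_eq

/-! ### Cosine coefficients of S(t)S(at) -/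

theorem integral_exp_mul_half_sub {z : ℂ} (hz : z ≠ 0) :
    ∫ s in (0 : ℝ)..1, Complex.exp (z * s) * (1 / 2 - s) =
      -(Complex.exp z + 1) / (2 * z) + (Complex.exp z - 1) / z ^ 2 := by
  have hd : ∀ s : ℝ, HasDerivAt
      (fun s : ℝ => Complex.exp (z * s) * ((1 / 2 - s) / z + 1 / z ^ 2))
      (Complex.exp (z * s) * (1 / 2 - s)) s := by
    intro s
    have h1 : HasDerivAt (fun s : ℝ => (s : ℂ)) 1 s := Complex.ofRealCLM.hasDerivAt
    have h2 := ((h1.const_mul z).cexp).mul (((h1.const_sub (1 / 2)).div_const z).add_const (1 / z ^ 2))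
    refine HasDerivAt.congr_deriv h2 ?_
    field_simp
    ring
  rw [intervalIntegral.integral_eq_sub_of_hasDerivAt (fun s _ => hd s)
    (Continuous.intervalIntegrable (by fun_prop) _ _)]
  simp
  field_simp
  ring

theorem integral_cos_mul_half_sub_sq {k : ℕ} (hk : 0 < k) :
    ∫ s in (0 : ℝ)..1, Real.cos (2 * Real.pi * (k * s)) * (1 / 2 - s) ^ 2 =
      1 / (2 * Real.pi ^ 2 * k ^ 2) := by
  have hpi := Real.pi_ne_zero
  have hk0 : (k : ℝ) ≠ 0 := by positivity
  have hd : ∀ s : ℝ, HasDerivAt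
      (fun s : ℝ => Real.sin (2 * Real.pi * (k * s)) * ((1 / 2 - s) ^ 2 / (2 * Real.pi * k)
          - 2 / (2 * Real.pi * k) ^ 3)
        - Real.cos (2 * Real.pi * (k * s)) * ((1 / 2 - s) * 2 / (2 * Real.pi * k) ^ 2))
      (Real.cos (2 * Real.pi * (k * s)) * (1 / 2 - s) ^ 2) s := by
    intro s
    have h0 := ((hasDerivAt_id s).const_mul (k : ℝ)).const_mul (2 * Real.pi)
    have h1 := (hasDerivAt_id s).const_sub (1 / 2)
    have h2 := (h0.sin.mul (((h1.pow 2).div_const (2 * Real.pi * k)).sub_const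
      (2 / (2 * Real.pi * k) ^ 3))).sub
      (h0.cos.mul ((h1.mul_const 2).div_const ((2 * Real.pi * k) ^ 2)))
    refine HasDerivAt.congr_deriv h2 ?_
    simp
    field_simp
    ring
  rw [intervalIntegral.integral_eq_sub_of_hasDerivAt (fun s _ => hd s)
    (Continuous.intervalIntegrable (by fun_prop) _ _)]
  have hc : Real.cos (2 * Real.pi * k) = 1 := by
    rw [mul_comm]; exact Real.cos_nat_mul_two_pi k
  have hs : Real.sin (2 * Real.pi * k) = 0 := by
    have := Real.sin_nat_mul_pi (2 * k)
    push_cast at this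
    rw [← this]; ring_nf
  simp [hc, hs]
  field_simp
  ring

/-- Summation by parts: multiplying by z − 1 leaves a boundary term and a full geometric sum, which
vanishes. -/
theorem sum_range_mul_pow {z : ℂ} (hz : z ≠ 1) {n : ℕ} (hzn : z ^ n = 1) :
    ∑ j ∈ Finset.range n, (j : ℂ) * z ^ j = n / (z - 1) := by
  have hz' := sub_ne_zero.2 hz
  have h : ∀ m : ℕ, (∑ j ∈ Finset.range m, (j : ℂ) * z ^ j) * (z - 1) =
      m * z ^ m - ∑ j ∈ Finset.range m, z ^ (j + 1) := by
    intro m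
    induction m with
    | zero => simp
    | succ m ih =>
      rw [Finset.sum_range_succ, Finset.sum_range_succ, add_mul, ih]
      push_cast
      ring
  have hg : ∑ j ∈ Finset.range n, z ^ j = 0 := by
    rw [geom_sum_eq hz, hzn, sub_self, zero_div]
  rw [eq_div_iff hz', h, hzn]
  simp_rw [pow_succ]
  rw [← Finset.sum_mul, hg]
  simp

theorem Real.cot_pi_mul_natCast (k : ℕ) : Real.cot (Real.pi * k) = 0 := by
  rw [Real.cot_eq_cos_div_sin, mul_comm, Real.sin_nat_mul_pi, div_zero]

theorem unitExp_div_eq_one_iff {a h : ℕ} (ha : 0 < a) : unitExp (h / a) = 1 ↔ a ∣ h := by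
  have ha0 : (a : ℝ) ≠ 0 := by positivity
  rw [unitExp_eq_one_iff]
  constructor
  · rintro ⟨n, hn⟩
    rw [div_eq_iff ha0] at hn
    have : (h : ℤ) = n * a := by exact_mod_cast hn
    exact Int.natCast_dvd_natCast.1 ⟨n, by rw [this, mul_comm]⟩
  · rintro ⟨k, rfl⟩
    exact ⟨k, by push_cast; field_simp⟩

/-- Splitting `[0, 1]` into `a` equal parts turns the cosine coefficient of a product of two
sawtooth functions into an integral of elementary functions. -/
theorem cosCoeff_sawtooth_mul_eq_integral {a : ℕ} (ha : 0 < a) (h : ℕ) :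
    cosCoeff (fun t => sawtooth t * sawtooth (a * t)) h =
      Real.pi ^ 2 / a * ∫ s in (0 : ℝ)..1, (∑ j ∈ Finset.range a,
        Real.cos (2 * Real.pi * (h * ((j + s) / a))) * (1 / 2 - (j + s) / a)) * (1 / 2 - s) := by
  have ha0 : (a : ℝ) ≠ 0 := by positivity
  have hb : ∀ t : ℝ, |sawtooth t * sawtooth (a * t)| ≤ Real.pi * Real.pi := by
    simpa using abs_sawtooth_mul_sawtooth_le 1 a
  have hm : Measurable fun t : ℝ => sawtooth t * sawtooth (a * t) := by
    simpa using measurable_sawtooth_mul_sawtooth 1 a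
  rw [cosCoeff, integral_zero_one_eq_sum (intervalIntegrable_cos_mul hm hb h) ha]
  have hterm : ∀ j ∈ Finset.range a, (∫ s in (0 : ℝ)..1,
      Real.cos (2 * Real.pi * (h * ((j + s) / a))) *
        (sawtooth ((j + s) / a) * sawtooth (a * ((j + s) / a)))) =
      ∫ s in (0 : ℝ)..1, Real.pi ^ 2 * (Real.cos (2 * Real.pi * (h * ((j + s) / a))) *
        (1 / 2 - (j + s) / a) * (1 / 2 - s)) := by
    intro j hj
    have hja : (j : ℝ) + 1 ≤ a := by exact_mod_cast Finset.mem_range.1 hj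
    refine intervalIntegral.integral_congr_ae ?_
    -- On the open piece both sawtooth factors are affine; s = 1 is discarded because the affine
    -- formula fails at integers.
    filter_upwards [Measure.ae_ne volume (1 : ℝ)] with s hs1 hs
    rw [uIoc_of_le zero_le_one] at hs
    have hlt : s < 1 := lt_of_le_of_ne hs.2 hs1
    have h1 : sawtooth (a * ((j + s) / a)) = Real.pi * (1 / 2 - s) := by
      have : sawtooth (j + s) = sawtooth s := by
        have := sawtooth_periodic.nat_mul j s
        rwa [mul_one, add_comm] at this
      rw [mul_div_cancel₀ _ ha0, this, sawtooth_of_mem_Ioo ⟨hs.1, hlt⟩]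
    have h2 : sawtooth ((j + s) / a) = Real.pi * (1 / 2 - (j + s) / a) := by
      refine sawtooth_of_mem_Ioo ⟨?_, ?_⟩
      · have := hs.1
        positivity
      · rw [div_lt_one (by positivity)]
        linarith
    rw [h1, h2]
    ring
  rw [Finset.sum_congr rfl hterm, ← intervalIntegral.integral_finsetSum fun j _ =>
    Continuous.intervalIntegrable (by fun_prop) _ _, smul_eq_mul, div_mul_eq_mul_div, mul_comm,
    ← div_eq_mul_inv, ← intervalIntegral.integral_const_mul]
  simp_rw [Finset.sum_mul, Finset.mul_sum]

/-- The distribution relation of the first Bernoulli polynomial. -/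
theorem sum_range_half_sub {a : ℕ} (ha : 0 < a) (s : ℝ) :
    ∑ j ∈ Finset.range a, (1 / 2 - (j + s) / a) = 1 / 2 - s := by
  have ha0 : (a : ℝ) ≠ 0 := by positivity
  have h : (∑ j ∈ Finset.range a, (j : ℝ)) * 2 = a * (a - 1) := by
    have := Finset.sum_range_id_mul_two a
    have h2 : ((a - 1 : ℕ) : ℝ) = a - 1 := by
      rw [Nat.cast_sub ha, Nat.cast_one]
    rw [← h2, ← Nat.cast_mul, ← this, Nat.cast_mul, Nat.cast_sum, Nat.cast_ofNat]
  rw [Finset.sum_sub_distrib, ← Finset.sum_div (f := fun j : ℕ => (j : ℝ) + s),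
    Finset.sum_add_distrib]
  simp only [Finset.sum_const, Finset.card_range, nsmul_eq_mul]
  field_simp
  linarith

theorem cosCoeff_sawtooth_mul_of_dvd {a k : ℕ} (ha : 0 < a) (hk : 0 < k) :
    cosCoeff (fun t => sawtooth t * sawtooth (a * t)) (a * k) =
      a / (2 * (a * k) ^ 2) := by
  have ha0 : (a : ℝ) ≠ 0 := by positivity
  have hk0 : (k : ℝ) ≠ 0 := by positivity
  have hpi := Real.pi_ne_zero
  rw [cosCoeff_sawtooth_mul_eq_integral ha]
  have : ∀ s : ℝ, (∑ j ∈ Finset.range a, Real.cos (2 * Real.pi * ((a * k : ℕ) * ((j + s) / a)))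
      * (1 / 2 - (j + s) / a)) * (1 / 2 - s)
      = Real.cos (2 * Real.pi * (k * s)) * (1 / 2 - s) ^ 2 := by
    intro s
    have hc : ∀ j : ℕ, Real.cos (2 * Real.pi * ((a * k : ℕ) * ((j + s) / a))) =
        Real.cos (2 * Real.pi * (k * s)) := by
      intro j
      rw [← Real.cos_add_nat_mul_two_pi (2 * Real.pi * (k * s)) (k * j)]
      congr 1
      push_cast
      field_simp
      ring
    simp_rw [hc]
    rw [← Finset.mul_sum, sum_range_half_sub ha]
    ring
  simp_rw [this]
  rw [integral_cos_mul_half_sub_sq hk]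
  field_simp

/-- With w = e^{2πih/a} ≠ 1, the part of the affine factor constant in j is killed by ∑ w^j = 0, and
the part linear in j gives ∑ j w^j = a/(w − 1). -/
theorem sum_range_cos_mul_half_sub {a h : ℕ} (ha : 0 < a) (hah : ¬ a ∣ h) (s : ℝ) :
    ∑ j ∈ Finset.range a, Real.cos (2 * Real.pi * (h * ((j + s) / a))) * (1 / 2 - (j + s) / a) =
      (-1 / (unitExp (h / a) - 1) * unitExp (h / a * s)).re := by
  have ha0 : (a : ℂ) ≠ 0 := by exact_mod_cast ha.ne'
  have hw : unitExp (h / a) ≠ 1 := fun e => hah ((unitExp_div_eq_one_iff ha).1 e)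
  have hw' := sub_ne_zero.2 hw
  have hwa : unitExp (h / a) ^ a = 1 := by
    rw [← unitExp_nat_mul, mul_div_cancel₀ _ (by positivity), unitExp_natCast]
  have hsum : ∑ j ∈ Finset.range a, unitExp (h / a) ^ j = 0 := by
    rw [geom_sum_eq hw, hwa, sub_self, zero_div]
  have hC : ∑ j ∈ Finset.range a, unitExp (h * ((j + s) / a)) * ((1 / 2 - (j + s) / a : ℝ) : ℂ) =
      -1 / (unitExp (h / a) - 1) * unitExp (h / a * s) := by
    have e : ∀ j : ℕ, unitExp (h * ((j + s) / a)) * ((1 / 2 - (j + s) / a : ℝ) : ℂ) =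
        unitExp (h / a * s) * ((1 / 2 - s / a) * unitExp (h / a) ^ j
          - 1 / a * (j * unitExp (h / a) ^ j)) := by
      intro j
      have : (h : ℝ) * ((j + s) / a) = h / a * s + j * (h / a) := by ring
      rw [this, unitExp_add, unitExp_nat_mul]
      push_cast
      ring
    simp_rw [e]
    rw [← Finset.mul_sum, Finset.sum_sub_distrib, ← Finset.mul_sum, ← Finset.mul_sum, hsum,
      sum_range_mul_pow hw hwa]
    field_simp
    ring
  rw [← hC, Complex.re_sum]
  refine Finset.sum_congr rfl fun j _ => ?_
  rw [Complex.re_mul_ofReal, re_unitExp]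

theorem cosCoeff_sawtooth_mul_of_not_dvd {a h : ℕ} (ha : 0 < a) (hah : ¬ a ∣ h) :
    cosCoeff (fun t => sawtooth t * sawtooth (a * t)) h =
      a / (4 * h ^ 2) - Real.pi / (4 * h) * Real.cot (Real.pi * h / a) := by
  have hh : h ≠ 0 := by rintro rfl; exact hah (dvd_zero a)
  have hh0 : (h : ℝ) ≠ 0 := by exact_mod_cast hh
  have ha0 : (a : ℝ) ≠ 0 := by positivity
  have hpi := Real.pi_ne_zero
  rw [cosCoeff_sawtooth_mul_eq_integral ha]
  simp_rw [sum_range_cos_mul_half_sub ha hah]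
  set z : ℂ := 2 * Real.pi * (h / a) * I with hz
  have hz0 : z ≠ 0 := by
    rw [hz]
    have : ((2 * Real.pi * (h / a) : ℝ) : ℂ) ≠ 0 := Complex.ofReal_ne_zero.2 (by positivity)
    push_cast at this
    exact mul_ne_zero this I_ne_zero
  have hexp : ∀ s : ℝ, unitExp (h / a * s) = Complex.exp (z * s) := by
    intro s
    rw [unitExp, hz]
    congr 1
    push_cast
    ring
  have hw : unitExp (h / a) = Complex.exp z := by simpa using hexp 1
  set w : ℂ := unitExp (h / a) with hwdef
  have hw1 : w - 1 ≠ 0 := sub_ne_zero.2 fun e => hah ((unitExp_div_eq_one_iff ha).1 e)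
  have hint : ∫ s in (0 : ℝ)..1, (-1 / (w - 1) * unitExp (h / a * s)).re * (1 / 2 - s) =
      (-1 / (w - 1) * (-(w + 1) / (2 * z) + (w - 1) / z ^ 2)).re := by
    rw [hw, ← integral_exp_mul_half_sub hz0, ← intervalIntegral.integral_const_mul]
    refine Eq.trans (intervalIntegral.integral_congr fun t _ => ?_)
      (intervalIntegral.intervalIntegral_re (Continuous.intervalIntegrable
        (by fun_prop : Continuous fun s : ℝ =>
          -1 / (Complex.exp z - 1) * (Complex.exp (z * s) * (1 / 2 - s))) 0 1))
    have : (1 / 2 - t : ℂ) = ((1 / 2 - t : ℝ) : ℂ) := by push_cast; ring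
    simp only [RCLike.re_to_complex]
    rw [hexp, this, ← mul_assoc, Complex.re_mul_ofReal]
  rw [hint]
  set θ : ℝ := Real.pi * h / a with hθ
  have hw2 : w = (Complex.cos θ + Complex.sin θ * I) ^ 2 := by
    rw [← Complex.exp_mul_I, ← Complex.exp_nat_mul, hw, hz, hθ]
    congr 1
    push_cast
    ring
  have hcs : Complex.cos θ ^ 2 + Complex.sin θ ^ 2 = 1 := Complex.cos_sq_add_sin_sq θ
  -- Half-angle factorisation with w = e^{2iθ}: the quotient (w + 1)/(w − 1) becomes −i cot θ, so
  -- its product with 1/(2z), z being imaginary, is real.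
  have hwm : w - 1 = 2 * Complex.sin θ * I * (Complex.cos θ + Complex.sin θ * I) := by
    rw [hw2, ← hcs]
    linear_combination -Complex.sin θ ^ 2 * Complex.I_sq
  have hwp : w + 1 = 2 * Complex.cos θ * (Complex.cos θ + Complex.sin θ * I) := by
    rw [hw2, ← hcs]
    linear_combination Complex.sin θ ^ 2 * Complex.I_sq
  have hs0 : Complex.sin θ ≠ 0 := fun e => hw1 (by rw [hwm, e]; ring)
  have he0 : Complex.cos θ + Complex.sin θ * I ≠ 0 := fun e => hw1 (by rw [hwm, e]; ring)
  have hq : -1 / (w - 1) * (-(w + 1) / (2 * z) + (w - 1) / z ^ 2) =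
      ((-(Real.cot θ * a / (4 * Real.pi * h)) + a ^ 2 / (4 * Real.pi ^ 2 * h ^ 2) : ℝ) : ℂ) := by
    have e1 : -1 / (w - 1) * (-(w + 1) / (2 * z) + (w - 1) / z ^ 2) =
        (w + 1) / (w - 1) * (1 / (2 * z)) - 1 / z ^ 2 := by
      field_simp
      ring
    have e2 : (w + 1) / (w - 1) = Complex.cos θ / (Complex.sin θ * I) := by
      rw [hwm, hwp]
      field_simp
    have hpc : (Real.pi : ℂ) ≠ 0 := by exact_mod_cast hpi
    have hac : (a : ℂ) ≠ 0 := by exact_mod_cast ha.ne'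
    have hhc : (h : ℂ) ≠ 0 := by exact_mod_cast hh
    have hI := I_ne_zero
    rw [e1, e2]
    push_cast
    rw [Complex.cot_eq_cos_div_sin, hz]
    field_simp
    rw [Complex.I_sq]
    ring
  rw [hq, Complex.ofReal_re]
  field_simp
  ring

/-- The two cases merge because `Real.cot` is 0 at its poles: for a ∣ h the cotangent term
disappears and the rational term doubles. -/
theorem cosCoeff_sawtooth_mul {a h : ℕ} (ha : 0 < a) (hh : 0 < h) :
    cosCoeff (fun t => sawtooth t * sawtooth (a * t)) h =
      a / (4 * h ^ 2) + (if a ∣ h then (a : ℝ) / (4 * h ^ 2) else 0)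
        - Real.pi / (4 * h) * Real.cot (Real.pi * h / a) := by
  split_ifs with hah
  · obtain ⟨k, rfl⟩ := hah
    have ha0 : (a : ℝ) ≠ 0 := by positivity
    have hk : 0 < k := Nat.pos_of_mul_pos_left hh
    have : Real.pi * ((a * k : ℕ) : ℝ) / a = Real.pi * k := by
      push_cast
      field_simp
    rw [cosCoeff_sawtooth_mul_of_dvd ha hk, this, Real.cot_pi_mul_natCast]
    push_cast
    ring
  · rw [cosCoeff_sawtooth_mul_of_not_dvd ha hah, add_zero]

/-! ### Averaging over translates by 1/b -/

theorem integral_zero_one_eq_integral_sum {E : Type*} [NormedAddCommGroup E] [NormedSpace ℝ E]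
    {f : ℝ → E} (hi : IntervalIntegrable f volume 0 1) {n : ℕ} (hn : 0 < n) :
    ∫ t in (0 : ℝ)..1, f t =
      (n : ℝ)⁻¹ • ∫ s in (0 : ℝ)..1, ∑ j ∈ Finset.range n, f ((j + s) / n) := by
  have hn0 : (n : ℝ) ≠ 0 := by positivity
  rw [integral_zero_one_eq_sum hi hn, intervalIntegral.integral_finsetSum]
  intro j hj
  have h1 : IntervalIntegrable f volume (j / n) ((j + 1) / n) := by
    refine hi.mono_set ?_
    rw [uIcc_of_le zero_le_one, uIcc_of_le (by gcongr; linarith)]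
    refine Icc_subset_Icc (by positivity) ?_
    rw [div_le_one (by positivity)]
    exact_mod_cast Finset.mem_range.1 hj
  have h2 := (h1.comp_mul_left (c := (n : ℝ)⁻¹)).comp_add_left j
  simpa [hn0, div_eq_inv_mul] using h2

theorem prod_one_sub_mul_pow {b : ℕ} (hb : 0 < b) {ζ : ℂ} (hζ : IsPrimitiveRoot ζ b) (y : ℂ) :
    ∏ j ∈ Finset.range b, (1 - ζ ^ j * y) = 1 - y ^ b := by
  have h := hζ.pow_sub_pow_eq_prod_sub_mul 1 y hb
  rw [one_pow] at h
  rw [h]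
  refine Finset.prod_bij (fun j _ => ζ ^ j) (fun j _ => ?_) (fun i hi j hj hij => ?_)
    (fun w hw => ?_) (fun j _ => rfl)
  · rw [Polynomial.mem_nthRootsFinset hb, ← pow_mul, mul_comm, pow_mul, hζ.pow_eq_one, one_pow]
  · exact hζ.pow_inj (Finset.mem_range.1 hi) (Finset.mem_range.1 hj) hij
  · have : NeZero b := ⟨hb.ne'⟩
    obtain ⟨i, hi, rfl⟩ := hζ.eq_pow_of_pow_eq_one ((Polynomial.mem_nthRootsFinset hb _).1 hw)
    exact ⟨i, Finset.mem_range.2 hi, rfl⟩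

/-- Coprimality makes e^{2πia/b} a primitive b-th root of unity, so the chords multiply to |1 − y^b|
with y = e^{2πias/b}. -/
theorem sum_logChord {a b : ℕ} (hb : 0 < b) (hab : a.Coprime b) {s : ℝ}
    (hs : unitExp (a * s) ≠ 1) :
    ∑ j ∈ Finset.range b, logChord (a * ((j + s) / b)) = logChord (a * s) := by
  have hb0 : (b : ℝ) ≠ 0 := by positivity
  have hζ : IsPrimitiveRoot (unitExp (a / b)) b := by
    convert Complex.isPrimitiveRoot_exp_of_coprime a b hb.ne' hab using 1
    rw [unitExp]
    congr 1
    push_cast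
    ring
  have hprod := prod_one_sub_mul_pow hb hζ (unitExp (a * s / b))
  rw [← unitExp_nat_mul, mul_div_cancel₀ _ hb0] at hprod
  have hterm : ∀ j : ℕ, unitExp (a * ((j + s) / b)) = unitExp (a / b) ^ j * unitExp (a * s / b) := by
    intro j
    rw [← unitExp_nat_mul, ← unitExp_add]
    congr 1
    ring
  simp_rw [logChord, hterm]
  rw [← Real.log_prod, ← norm_prod, hprod]
  intro j hj
  rw [norm_ne_zero_iff]
  exact Finset.prod_ne_zero_iff.1 (hprod ▸ sub_ne_zero.2 hs.symm) j hj

/-- The factor g(bt) is unchanged by t ↦ t + 1/b, so only the logarithm is averaged, and its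
translates sum back to the same logarithm. -/
theorem integral_logChord_mul_comp {a b : ℕ} (ha : 0 < a) (hb : 0 < b) (hab : a.Coprime b)
    {g : ℝ → ℝ} (hg : Function.Periodic g 1)
    (hi : IntervalIntegrable (fun t => logChord (a * t) * g (b * t)) volume 0 1) :
    ∫ t in (0 : ℝ)..1, logChord (a * t) * g (b * t) =
      (b : ℝ)⁻¹ * ∫ t in (0 : ℝ)..1, logChord (a * t) * g t := by
  have hb0 : (b : ℝ) ≠ 0 := by positivity
  rw [integral_zero_one_eq_integral_sum hi hb, smul_eq_mul]
  congr 1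
  refine intervalIntegral.integral_congr_ae ?_
  filter_upwards [ae_unitExp_nat_mul_ne_one ha] with s hs _
  rw [← sum_logChord hb hab hs, Finset.sum_mul]
  refine Finset.sum_congr rfl fun j _ => ?_
  congr 1
  have := hg.nat_mul j s
  rwa [mul_one, add_comm, ← mul_div_cancel₀ ((j : ℝ) + s) hb0] at this

/-! ### Cosine coefficients of S(2t)S(dt) -/

/-- Expand S(2t) = S(t) + S(t + 1/2) and translate the second term by 1/2. The cosine acquires
(−1)^n, and since d is odd S(dt) becomes S(dt + 1/2) = S(2dt) − S(dt). -/
theorem cosCoeff_sawtooth_two_mul {d : ℕ} (hd : Odd d) (n : ℕ) :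
    cosCoeff (fun t => sawtooth (2 * t) * sawtooth (d * t)) n =
      (1 - (-1) ^ n) * cosCoeff (fun t => sawtooth t * sawtooth (d * t)) n
      + (-1) ^ n * cosCoeff (fun t => sawtooth t * sawtooth ((2 * d : ℕ) * t)) n := by
  have hb := fun a : ℕ => abs_sawtooth_mul_sawtooth_le 1 a
  have hm := fun a : ℕ => measurable_sawtooth_mul_sawtooth 1 a
  simp only [Nat.cast_one, one_mul] at hb hm
  have hi := fun a : ℕ => intervalIntegrable_cos_mul (hm a) (hb a) n
  -- The translated integrand (−1)^n cos(2πnt) S(t) (S(2dt) − S(dt)).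
  let G : ℝ → ℝ := fun t =>
    (-1) ^ n * (Real.cos (2 * Real.pi * (n * t)) * (sawtooth t * sawtooth ((2 * d : ℕ) * t)))
      - (-1) ^ n * (Real.cos (2 * Real.pi * (n * t)) * (sawtooth t * sawtooth (d * t)))
  have hGi : IntervalIntegrable G volume 0 1 := ((hi (2 * d)).const_mul _).sub ((hi d).const_mul _)
  have hsper : ∀ (m : ℕ) (t : ℝ), sawtooth (m * (t + 1)) = sawtooth (m * t) := by
    intro m t
    have := sawtooth_periodic.nat_mul m (m * t)
    rwa [← mul_add] at this
  have hGper : Function.Periodic G 1 := by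
    intro t
    have hc : Real.cos (2 * Real.pi * (n * (t + 1))) = Real.cos (2 * Real.pi * (n * t)) := by
      rw [← Real.cos_add_nat_mul_two_pi (2 * Real.pi * (n * t)) n]
      congr 1
      ring
    simp only [G, hc, hsper, sawtooth_periodic t]
  have hGi' := hGper.intervalIntegrable one_ne_zero (t := 0) (by simpa using hGi)
  have hshift : ∀ t : ℝ, G (t + 1 / 2) =
      Real.cos (2 * Real.pi * (n * t)) * (sawtooth (t + 1 / 2) * sawtooth (d * t)) := by
    intro t
    have hc : Real.cos (2 * Real.pi * (n * (t + 1 / 2))) =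
        (-1) ^ n * Real.cos (2 * Real.pi * (n * t)) := by
      rw [← Real.cos_add_nat_mul_pi]
      congr 1
      ring
    obtain ⟨k, rfl⟩ := hd
    have h1 : sawtooth ((2 * k + 1 : ℕ) * (t + 1 / 2)) =
        sawtooth ((2 * k + 1 : ℕ) * t + 1 / 2) := by
      have := sawtooth_periodic.nat_mul k ((2 * k + 1 : ℕ) * t + 1 / 2)
      rw [← this]
      congr 1
      push_cast
      ring
    have h2 : sawtooth ((2 * (2 * k + 1) : ℕ) * (t + 1 / 2)) =
        sawtooth ((2 * k + 1 : ℕ) * t) + sawtooth ((2 * k + 1 : ℕ) * t + 1 / 2) := by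
      rw [← sawtooth_two_mul]
      have := sawtooth_periodic.nat_mul (2 * k + 1) (2 * ((2 * k + 1 : ℕ) * t))
      rw [← this]
      congr 1
      push_cast
      ring
    have hsq : ((-1 : ℝ) ^ n) * (-1) ^ n = 1 := by
      rw [← mul_pow]
      norm_num
    simp only [G, hc, h1, h2]
    linear_combination (Real.cos (2 * Real.pi * (n * t)) * (sawtooth (t + 1 / 2)
      * sawtooth ((2 * k + 1 : ℕ) * t))) * hsq
  have hint : ∫ t in (0 : ℝ)..1, G (t + 1 / 2) = ∫ t in (0 : ℝ)..1, G t := by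
    have := hGper.intervalIntegral_add_eq (1 / 2) 0
    rw [intervalIntegral.integral_comp_add_right, zero_add, add_comm 1]
    rwa [zero_add] at this
  have hGint : ∫ t in (0 : ℝ)..1, G t =
      (-1) ^ n * cosCoeff (fun t => sawtooth t * sawtooth ((2 * d : ℕ) * t)) n
      - (-1) ^ n * cosCoeff (fun t => sawtooth t * sawtooth (d * t)) n := by
    rw [cosCoeff, cosCoeff, ← intervalIntegral.integral_const_mul,
      ← intervalIntegral.integral_const_mul, ← intervalIntegral.integral_sub
      ((hi (2 * d)).const_mul _) ((hi d).const_mul _)]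
  have hGi2 : IntervalIntegrable (fun t => G (t + 1 / 2)) volume 0 1 := by
    simpa using (hGi' (1 / 2) (1 + 1 / 2)).comp_add_right (1 / 2)
  have hsplit : cosCoeff (fun t => sawtooth (2 * t) * sawtooth (d * t)) n =
      cosCoeff (fun t => sawtooth t * sawtooth (d * t)) n + ∫ t in (0 : ℝ)..1, G (t + 1 / 2) := by
    rw [cosCoeff, cosCoeff, ← intervalIntegral.integral_add (hi d) hGi2]
    refine intervalIntegral.integral_congr fun t _ => ?_
    simp only [hshift, sawtooth_two_mul]
    ring
  rw [hsplit, hint, hGint]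
  ring

/-! ### Series for ζ(3) and cotangent series -/

/-- The real number `ζ(3)`. -/
noncomputable def zetaThree : ℝ := ∑' n : ℕ, 1 / (n : ℝ) ^ 3

theorem hasSum_zetaThree : HasSum (fun n : ℕ => 1 / (n : ℝ) ^ 3) zetaThree :=
  (Real.summable_one_div_nat_pow.2 (by norm_num)).hasSum

theorem ofReal_zetaThree : (zetaThree : ℂ) = riemannZeta 3 := by
  have h := zeta_nat_eq_tsum_of_gt_one (k := 3) (by norm_num)
  push_cast at h
  rw [h, zetaThree, Complex.ofReal_tsum]
  push_cast
  rfl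

theorem hasSum_zetaThree_dvd {d : ℕ} (hd : 0 < d) :
    HasSum (fun n : ℕ => if d ∣ n then 1 / (n : ℝ) ^ 3 else 0) (zetaThree / d ^ 3) := by
  have hinj : Function.Injective fun k : ℕ => d * k := fun x y h => Nat.eq_of_mul_eq_mul_left hd h
  rw [← hinj.hasSum_iff]
  · refine (congrArg (fun f => HasSum f _) (funext fun k => ?_)).mpr
      (hasSum_zetaThree.div_const ((d : ℝ) ^ 3))
    simp [mul_pow, div_eq_mul_inv]
  · intro n hn
    rw [if_neg]
    rintro ⟨k, rfl⟩
    exact hn ⟨k, rfl⟩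

theorem Real.cot_add_nat_mul_pi (x : ℝ) (n : ℕ) : Real.cot (x + n * Real.pi) = Real.cot x := by
  have h : ((-1 : ℝ) ^ n) ≠ 0 := by positivity
  rw [Real.cot_eq_cos_div_sin, Real.cot_eq_cos_div_sin, Real.cos_add_nat_mul_pi,
    Real.sin_add_nat_mul_pi, mul_div_mul_left _ _ h]

theorem Real.cot_nat_mul_pi_div_two (n : ℕ) : Real.cot (n * (Real.pi / 2)) = 0 := by
  obtain ⟨k, rfl | rfl⟩ := n.even_or_odd'
  · rw [← Real.cot_pi_mul_natCast k]
    congr 1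
    push_cast
    ring
  · rw [show ((2 * k + 1 : ℕ) : ℝ) * (Real.pi / 2) = Real.pi / 2 + k * Real.pi by push_cast; ring,
      Real.cot_add_nat_mul_pi, Real.cot_eq_cos_div_sin, Real.cos_pi_div_two, zero_div]

/-- The cotangent depends only on n mod q, hence is bounded by a finite sum over residues; poles
contribute 0. -/
theorem summable_cot_div_sq (p : ℕ) {q : ℕ} (hq : 0 < q) :
    Summable fun n : ℕ => Real.cot (Real.pi * (p * n) / q) / (n : ℝ) ^ 2 := by
  have hq0 : (q : ℝ) ≠ 0 := by positivity
  set C : ℝ := ∑ j ∈ Finset.range q, |Real.cot (Real.pi * (p * j) / q)| with hC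
  have hb : ∀ n : ℕ, |Real.cot (Real.pi * (p * n) / q)| ≤ C := by
    intro n
    have e : Real.pi * (p * n) / q =
        Real.pi * (p * (n % q : ℕ)) / q + (p * (n / q) : ℕ) * Real.pi := by
      have : (n : ℝ) = (n % q : ℕ) + q * (n / q : ℕ) := by exact_mod_cast (Nat.mod_add_div n q).symm
      conv_lhs => rw [this]
      push_cast
      field_simp
    rw [e, Real.cot_add_nat_mul_pi]
    exact Finset.single_le_sum (f := fun j : ℕ => |Real.cot (Real.pi * (p * j) / q)|)
      (fun _ _ => abs_nonneg _) (Finset.mem_range.2 (Nat.mod_lt n hq))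
  refine Summable.of_norm_bounded
    ((Real.summable_one_div_nat_pow.2 one_lt_two).mul_left C) fun n => ?_
  rw [norm_div, Real.norm_eq_abs, norm_pow, Real.norm_natCast, mul_one_div]
  gcongr
  exact hb n

/-! ### Evaluation of the integrals -/

theorem integral_logChord_mul_of_hasSum {p : ℕ} (hp : 0 < p) {g : ℝ → ℝ} (hg : Measurable g)
    {C : ℝ} (hC : ∀ t, |g t| ≤ C) {S : ℝ} (hs : HasSum (fun n : ℕ => cosCoeff g (p * n) / n) S) :
    ∫ t in (0 : ℝ)..1, logChord (p * t) * g t = -S := by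
  rw [integral_logChord_mul hp hg hC hs.summable, hs.tsum_eq]

/-- Y collects the doubled rational terms, at those n for which a divides pn; it is left open
because its value depends on gcd(a, p). -/
theorem integral_logChord_mul_sawtooth {a p : ℕ} (ha : 0 < a) (hp : 0 < p) {Y : ℝ}
    (hY : HasSum (fun n : ℕ => if a ∣ p * n then 1 / (n : ℝ) ^ 3 else 0) Y) :
    ∫ t in (0 : ℝ)..1, logChord (p * t) * (sawtooth t * sawtooth (a * t)) =
      -(a / (4 * p ^ 2)) * (zetaThree + Y)
        + Real.pi / (4 * p) * ∑' n : ℕ, Real.cot (Real.pi * (p * n) / a) / (n : ℝ) ^ 2 := by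
  have hp0 : (p : ℝ) ≠ 0 := by positivity
  have hb := abs_sawtooth_mul_sawtooth_le 1 a
  have hm := measurable_sawtooth_mul_sawtooth 1 a
  simp only [Nat.cast_one, one_mul] at hb hm
  have h := ((hasSum_zetaThree.add hY).mul_left ((a : ℝ) / (4 * p ^ 2))).sub
    ((summable_cot_div_sq p ha).hasSum.mul_left (Real.pi / (4 * p)))
  rw [integral_logChord_mul_of_hasSum hp hm hb
    ((congrArg (fun f => HasSum f _) (funext fun n => ?_)).mpr h)]
  · ring
  · rcases n.eq_zero_or_pos with rfl | hn
    · simp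
    · have hn0 : (n : ℝ) ≠ 0 := by positivity
      rw [cosCoeff_sawtooth_mul ha (mul_pos hp hn)]
      push_cast
      split_ifs <;> field_simp <;> ring

/-- With x = πn/(2d), even n contribute cot x and odd n contribute 2 cot 2x − cot x = cot(x + π/2).
Both are cot(x + nπ/2), whence the factor d + 1. -/
theorem integral_logChord_mul_sawtooth_two {d : ℕ} (hd : Odd d) :
    ∫ t in (0 : ℝ)..1, logChord t * (sawtooth (2 * t) * sawtooth (d * t)) =
      -(d / 2) * (zetaThree / d ^ 3 + zetaThree / 8)
        + Real.pi / 4 *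
          ∑' n : ℕ, Real.cot (Real.pi * ((d + 1) * n) / (2 * d)) / (n : ℝ) ^ 2 := by
  have hd1 : 0 < d := hd.pos
  have hd0 : (d : ℝ) ≠ 0 := by positivity
  have hb := abs_sawtooth_mul_sawtooth_le 2 d
  have hm := measurable_sawtooth_mul_sawtooth 2 d
  have hcot := summable_cot_div_sq (d + 1) (q := 2 * d) (by positivity)
  have h2 := hasSum_zetaThree_dvd two_pos
  push_cast at hb hm hcot h2
  rw [show (2 : ℝ) ^ 3 = 8 by norm_num] at h2
  have h := (((hasSum_zetaThree_dvd hd1).add h2).mul_left ((d : ℝ) / 2)).sub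
    (hcot.hasSum.mul_left (Real.pi / 4))
  have hmain := integral_logChord_mul_of_hasSum one_pos hm hb
    ((congrArg (fun f => HasSum f _) (funext fun n => ?_)).mpr h)
  · simp only [Nat.cast_one, one_mul] at hmain
    rw [hmain]
    ring
  · rcases n.eq_zero_or_pos with rfl | hn
    · simp
    have hn0 : (n : ℝ) ≠ 0 := by positivity
    rw [one_mul, cosCoeff_sawtooth_two_mul hd, cosCoeff_sawtooth_mul hd1 hn,
      cosCoeff_sawtooth_mul (by positivity) hn]
    set x : ℝ := Real.pi * n / (2 * d) with hx
    have hxd : Real.pi * n / d = 2 * x := by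
      rw [hx]
      field_simp
    have hx2 : Real.pi * n / ((2 * d : ℕ) : ℝ) = x := by
      rw [hx]
      push_cast
      rfl
    have hx3 : Real.pi * ((d + 1) * n) / (2 * d) = x + n * (Real.pi / 2) := by
      rw [hx]
      field_simp
      ring
    rw [hxd, hx2, hx3]
    rcases n.even_or_odd with he | ho
    · obtain ⟨k, hk⟩ := he
      have h2n : 2 ∣ n := ⟨k, by rw [hk, two_mul]⟩
      have hiff : 2 * d ∣ n ↔ d ∣ n := by
        constructor
        · exact fun h => (Dvd.intro_left 2 rfl).trans h
        · exact fun h => (Nat.coprime_two_left.2 hd).mul_dvd_of_dvd_of_dvd h2n h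
      have hc : Real.cot (x + n * (Real.pi / 2)) = Real.cot x := by
        rw [← Real.cot_add_nat_mul_pi x k]
        congr 1
        rw [hk]
        push_cast
        ring
      rw [hc, Even.neg_one_pow ⟨k, hk⟩, if_pos h2n]
      simp only [hiff]
      push_cast
      split_ifs <;> field_simp <;> ring
    · have h2n : ¬ 2 ∣ n := by
        rw [← even_iff_two_dvd]
        exact Nat.not_even_iff_odd.2 ho
      have h2dn : ¬ 2 * d ∣ n := fun h => h2n ((Dvd.intro d rfl).trans h)
      obtain ⟨k, hk⟩ := ho
      have hc : Real.cot (x + n * (Real.pi / 2)) = 2 * Real.cot (2 * x) - Real.cot x := by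
        have e : x + n * (Real.pi / 2) = (x + Real.pi / 2) + k * Real.pi := by
          rw [hk]
          push_cast
          ring
        have hsx : Real.sin x ≠ 0 := by
          intro hs
          obtain ⟨m, hm⟩ := Real.sin_eq_zero_iff.1 hs
          rw [hx] at hm
          have hpi := Real.pi_ne_zero
          field_simp at hm
          have : (m : ℤ) * 2 * d = n := by exact_mod_cast hm
          refine h2dn (Int.natCast_dvd_natCast.1 ⟨m, ?_⟩)
          push_cast
          linarith
        rw [e, Real.cot_add_nat_mul_pi, Real.cot_eq_cos_div_sin, Real.cot_eq_cos_div_sin,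
          Real.cot_eq_cos_div_sin, Real.cos_add_pi_div_two, Real.sin_add_pi_div_two,
          Real.sin_two_mul, Real.cos_two_mul']
        -- When cos x = 0, every quotient in the identity is 0, through a zero numerator or a zero
        -- denominator.
        by_cases hcx : Real.cos x = 0
        · simp [hcx]
        · field_simp
          ring
      rw [hc, Odd.neg_one_pow ⟨k, hk⟩, if_neg h2n, if_neg h2dn]
      push_cast
      split_ifs <;> field_simp <;> ring

/-- Two of the three integrals coincide and carry the cotangent series; in the one with L(at) all
cotangents sit at multiples of π. -/
theorem integral_logChord_cube_one {a : ℕ} (ha : 0 < a) :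
    ∫ t in (0 : ℝ)..1, logChord (a * t) * logChord t * logChord t =
      -((2 + a ^ 3) / (2 * a ^ 2)) * zetaThree
        + Real.pi / 2 * ∑' n : ℕ, Real.cot (Real.pi * n / a) / (n : ℝ) ^ 2 := by
  have ha0 : (a : ℝ) ≠ 0 := by positivity
  have h := integral_logChord_mul_mul ha one_pos one_pos
  have h1 := integral_logChord_mul_sawtooth one_pos ha
    (by simpa only [one_dvd, if_true] using hasSum_zetaThree)
  have h2 := integral_logChord_mul_sawtooth ha one_pos
    (by simpa only [one_mul] using hasSum_zetaThree_dvd ha)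
  have hz : ∀ n : ℕ, Real.cot (Real.pi * (a * n)) = 0 := fun n => by
    simpa using Real.cot_pi_mul_natCast (a * n)
  simp only [Nat.cast_one, one_mul, div_one, hz, zero_div, tsum_zero] at h h1 h2
  simp only [mul_comm (sawtooth ((a : ℝ) * _))] at h
  rw [h, h1, h2]
  field_simp
  ring

theorem integral_logChord_mul_sq {a b : ℕ} (ha : 0 < a) (hb : 0 < b) (hab : a.Coprime b) :
    ∫ t in (0 : ℝ)..1, logChord (a * t) * logChord (b * t) * logChord (b * t) =
      -((2 + a ^ 3) / (2 * a ^ 2 * b)) * zetaThree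
        + Real.pi / (2 * b) * ∑' n : ℕ, Real.cot (Real.pi * n / a) / (n : ℝ) ^ 2 := by
  have hi := intervalIntegrable_logChord_mul_mul ha hb hb
  have h1 := integral_logChord_cube_one ha
  have hper : Function.Periodic (fun t => logChord t * logChord t) 1 := fun t => by
    simp only [logChord_periodic t]
  simp only [mul_assoc (logChord _)] at hi h1 ⊢
  rw [integral_logChord_mul_comp ha hb hab hper hi, h1]
  field_simp

theorem integral_logChord_one_four {d : ℕ} (hd : Odd d) :
    ∫ t in (0 : ℝ)..1, logChord t * logChord (4 * t) * logChord ((2 * d : ℕ) * t) =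
      -((9 + d ^ 3) / (16 * d ^ 2)) * zetaThree
        + Real.pi / 16 * ∑' n : ℕ, Real.cot (Real.pi * (2 * n) / d) / (n : ℝ) ^ 2
        + Real.pi / 8 *
          ∑' n : ℕ, Real.cot (Real.pi * ((d + 1) * n) / (2 * d)) / (n : ℝ) ^ 2 := by
  have hd1 : 0 < d := hd.pos
  have hd0 : (d : ℝ) ≠ 0 := by positivity
  have h2d : 0 < 2 * d := by positivity
  have h := integral_logChord_mul_mul one_pos four_pos h2d
  have hcop : Nat.Coprime d 2 := Nat.coprime_two_right.2 hd
  have i4 := integral_logChord_mul_sawtooth h2d four_pos (Y := zetaThree / d ^ 3) (by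
    refine (congrArg (fun f => HasSum f _) (funext fun n => ?_)).mpr (hasSum_zetaThree_dvd hd1)
    have : 2 * d ∣ 4 * n ↔ d ∣ n := by
      rw [show 4 * n = 2 * (2 * n) by ring, Nat.mul_dvd_mul_iff_left two_pos]
      exact hcop.dvd_mul_left
    simp only [this])
  have i2d := integral_logChord_mul_sawtooth four_pos h2d (Y := zetaThree / 8) (by
    have h2 := hasSum_zetaThree_dvd two_pos
    push_cast at h2
    rw [show (2 : ℝ) ^ 3 = 8 by norm_num] at h2
    refine (congrArg (fun f => HasSum f _) (funext fun n => ?_)).mpr h2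
    have : 4 ∣ 2 * d * n ↔ 2 ∣ n := by
      rw [show 2 * d * n = 2 * (d * n) by ring, show 4 = 2 * 2 by norm_num,
        Nat.mul_dvd_mul_iff_left two_pos]
      exact hcop.symm.dvd_mul_left
    simp only [this])
  -- These arguments are multiples of π/2, so the integral with L(2dt) has no cotangent part.
  have hz : ∀ n : ℕ, Real.cot (Real.pi * ((2 * d : ℕ) * n) / (4 : ℕ)) = 0 := by
    intro n
    rw [← Real.cot_nat_mul_pi_div_two (d * n)]
    congr 1
    push_cast
    ring
  -- The frequencies 4 and 2d share the factor 2, which the averaging lemma with b = 2 removes.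
  have i1 : ∫ t in (0 : ℝ)..1, logChord t * (sawtooth (4 * t) * sawtooth ((2 * d : ℕ) * t)) =
      2⁻¹ * ∫ t in (0 : ℝ)..1, logChord t * (sawtooth (2 * t) * sawtooth (d * t)) := by
    have hper : Function.Periodic (fun t => sawtooth (2 * t) * sawtooth (d * t)) 1 := by
      intro t
      have e := fun m : ℕ => sawtooth_periodic.nat_mul m (m * t)
      have e2 := e 2
      have ed := e d
      rw [← mul_add] at e2 ed
      push_cast at e2
      simp only [e2, ed]
    have e : ∀ t : ℝ, sawtooth (4 * t) * sawtooth ((2 * d : ℕ) * t) =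
        sawtooth (2 * ((2 : ℕ) * t)) * sawtooth (d * ((2 : ℕ) * t)) := by
      intro t
      congr 2 <;> push_cast <;> ring
    have hi := intervalIntegrable_logChord_mul one_pos
      (measurable_sawtooth_mul_sawtooth 4 (2 * d)) (abs_sawtooth_mul_sawtooth_le 4 (2 * d))
    simp only [Nat.cast_ofNat (n := 4), e] at hi
    have := integral_logChord_mul_comp one_pos two_pos (Nat.coprime_one_left 2) hper hi
    simp only [e]
    simpa only [Nat.cast_one, one_mul, Nat.cast_ofNat] using this
  rw [integral_logChord_mul_sawtooth_two hd] at i1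
  simp only [hz, zero_div, tsum_zero] at i2d
  have hc : ∀ n : ℕ, Real.pi * ((4 : ℕ) * n) / (2 * d : ℕ) = Real.pi * (2 * n) / d := by
    intro n
    push_cast
    field_simp
    ring
  simp only [hc] at i4
  simp only [Nat.cast_one, one_mul, Nat.cast_ofNat] at h i4 i2d
  rw [h, i1, i4, i2d]
  push_cast
  field_simp
  ring

/-! ### Translation to Mahler measures and to the restricted series -/

open Polynomial in
theorem log_norm_eval_X_pow_sub_one (n : ℕ) (t : ℝ) :
    Real.log ‖(X ^ n - 1 : ℂ[X]).eval (unitExp t)‖ = logChord (n * t) := by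
  rw [logChord, unitExp_nat_mul, norm_sub_rev]
  simp

open Polynomial in
theorem multipleMahlerMeasure_X_pow_sub_one (p q r : ℕ) :
    multipleMahlerMeasure ![X ^ p - 1, X ^ q - 1, X ^ r - 1] =
      ∫ t in (0 : ℝ)..1, logChord (p * t) * logChord (q * t) * logChord (r * t) := by
  rw [multipleMahlerMeasure, circleAverage_eq_integral_unitExp]
  refine intervalIntegral.integral_congr fun t _ => ?_
  simp only [Fin.prod_univ_three, Complex.ofReal_one, one_mul, ← log_norm_eval_X_pow_sub_one]
  rfl

open Polynomial in
theorem multipleMahlerIntegrable_X_pow_sub_one {p q r : ℕ} (hp : 0 < p) (hq : 0 < q)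
    (hr : 0 < r) : MultipleMahlerIntegrable ![X ^ p - 1, X ^ q - 1, X ^ r - 1] := by
  refine circleIntegrable_of_comp_unitExp ?_
  have h := intervalIntegrable_logChord_mul_mul hp hq hr
  simp only [← log_norm_eval_X_pow_sub_one] at h
  simp only [Fin.prod_univ_three]
  exact h

/-- The excluded indices contribute 0 under the conventions for cot and for division by zero, so
sums over all n and restricted sums agree. -/
theorem cot_div_sq_eq_zero {x : ℕ → ℝ} {P : ℕ → Prop}
    (hx : ∀ n, P n → ∃ k : ℕ, x n = Real.pi * k) :
    Function.support (fun n : ℕ => Real.cot (x n) / (n : ℝ) ^ 2) ⊆ {n | 1 ≤ n ∧ ¬ P n} := by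
  intro n hn
  refine ⟨Nat.one_le_iff_ne_zero.2 ?_, fun hP => hn ?_⟩
  · rintro rfl
    simp at hn
  · obtain ⟨k, hk⟩ := hx n hP
    simp only [hk, Real.cot_pi_mul_natCast, zero_div]

theorem exists_pi_mul_div_eq_of_dvd {a m : ℕ} (h : a ∣ m) :
    ∃ k : ℕ, Real.pi * (m : ℝ) / a = Real.pi * k := by
  obtain ⟨k, rfl⟩ := h
  rcases a.eq_zero_or_pos with rfl | ha
  · exact ⟨0, by simp⟩
  · exact ⟨k, by push_cast; field_simp⟩

theorem tsum_eq_LSeries {N : ℕ} [NeZero N] (χ : DirichletCharacter ℂ N) (f : ℕ → ℝ)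
    (hf : ∀ n : ℕ, (f n : ℂ) = χ (n : ZMod N)) :
    ((∑' n : ℕ, f n / (n : ℝ) ^ 2 : ℝ) : ℂ) = LSeries (fun n : ℕ => χ (n : ZMod N)) 2 := by
  rw [LSeries, Complex.ofReal_tsum]
  refine tsum_congr fun n => ?_
  rcases n.eq_zero_or_pos with rfl | hn
  · simp
  · rw [LSeries.term_of_ne_zero hn.ne', ← hf]
    push_cast
    norm_cast

/-- Both sides have period 3 in n, so the values cot(π/3) = 1/√3 and cot(2π/3) = −1/√3, and 0 at the
pole, suffice. -/
theorem cot_eq_chiNegThree (n : ℕ) :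
    ((Real.sqrt 3 * Real.cot (Real.pi * n / 3) : ℝ) : ℂ) = chiNegThree (n : ZMod 3) := by
  have h3 : Real.sqrt 3 * Real.sqrt 3 = 3 := Real.mul_self_sqrt (by norm_num)
  have hs : Real.sqrt 3 ≠ 0 := by positivity
  have e : Real.pi * n / 3 = Real.pi * (n % 3 : ℕ) / 3 + (n / 3 : ℕ) * Real.pi := by
    have : (n : ℝ) = (n % 3 : ℕ) + 3 * (n / 3 : ℕ) := by exact_mod_cast (Nat.mod_add_div n 3).symm
    conv_lhs => rw [this]
    ring
  have em : (n : ZMod 3) = ((n % 3 : ℕ) : ZMod 3) := (ZMod.natCast_mod n 3).symm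
  rw [e, Real.cot_add_nat_mul_pi, em, chiNegThree, MulChar.ringHomComp_apply]
  have hlt := Nat.mod_lt n (by norm_num : 3 > 0)
  interval_cases n % 3
  · have : quadraticChar (ZMod 3) ((0 : ℕ) : ZMod 3) = 0 := by decide
    rw [this]
    simp [Real.cot_eq_cos_div_sin]
  · have : quadraticChar (ZMod 3) ((1 : ℕ) : ZMod 3) = 1 := by decide
    rw [this]
    have : Real.sqrt 3 * Real.cot (Real.pi * (1 : ℕ) / 3) = 1 := by
      rw [Nat.cast_one, mul_one, Real.cot_eq_cos_div_sin, Real.cos_pi_div_three,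
        Real.sin_pi_div_three]
      field_simp
    rw [this]
    simp
  · have : quadraticChar (ZMod 3) ((2 : ℕ) : ZMod 3) = -1 := by decide
    rw [this]
    have : Real.sqrt 3 * Real.cot (Real.pi * (2 : ℕ) / 3) = -1 := by
      rw [show Real.pi * ((2 : ℕ) : ℝ) / 3 = Real.pi - Real.pi / 3 by push_cast; ring,
        Real.cot_eq_cos_div_sin, Real.cos_pi_sub, Real.sin_pi_sub, Real.cos_pi_div_three,
        Real.sin_pi_div_three]
      field_simp
    rw [this]
    simp

theorem cot_eq_chiNegFour (n : ℕ) :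
    ((Real.cot (Real.pi * n / 4) : ℝ) : ℂ) = chiNegFour (n : ZMod 4) := by
  have e : Real.pi * n / 4 = Real.pi * (n % 4 : ℕ) / 4 + (n / 4 : ℕ) * Real.pi := by
    have : (n : ℝ) = (n % 4 : ℕ) + 4 * (n / 4 : ℕ) := by exact_mod_cast (Nat.mod_add_div n 4).symm
    conv_lhs => rw [this]
    ring
  have em : (n : ZMod 4) = ((n % 4 : ℕ) : ZMod 4) := (ZMod.natCast_mod n 4).symm
  rw [e, Real.cot_add_nat_mul_pi, em, chiNegFour, MulChar.ringHomComp_apply]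
  have hlt := Nat.mod_lt n (by norm_num : 4 > 0)
  have h2 : Real.sqrt 2 ≠ 0 := by positivity
  have h1 : Real.cot (Real.pi / 4) = 1 := by
    rw [Real.cot_eq_cos_div_sin, Real.cos_pi_div_four, Real.sin_pi_div_four]
    field_simp
  interval_cases n % 4
  · have : ZMod.χ₄ ((0 : ℕ) : ZMod 4) = 0 := by decide
    rw [this]
    simp [Real.cot_eq_cos_div_sin]
  · have : ZMod.χ₄ ((1 : ℕ) : ZMod 4) = 1 := by decide
    rw [this, Nat.cast_one, mul_one, h1]
    simp
  · have : ZMod.χ₄ ((2 : ℕ) : ZMod 4) = 0 := by decide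
    rw [this, show Real.pi * ((2 : ℕ) : ℝ) / 4 = (1 : ℕ) * (Real.pi / 2) by push_cast; ring,
      Real.cot_nat_mul_pi_div_two]
    simp
  · have : ZMod.χ₄ ((3 : ℕ) : ZMod 4) = -1 := by decide
    rw [this, show Real.pi * ((3 : ℕ) : ℝ) / 4 = Real.pi - Real.pi / 4 by push_cast; ring,
      Real.cot_eq_cos_div_sin, Real.cos_pi_sub, Real.sin_pi_sub, neg_div,
      ← Real.cot_eq_cos_div_sin, h1]
    simp

open Polynomial in
theorem multipleMahlerMeasure_pow_sub_one_sq {a b : ℕ} (ha : 0 < a) (hb : 0 < b)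
    (hab : a.Coprime b) :
    (multipleMahlerMeasure ![X ^ a - 1, X ^ b - 1, X ^ b - 1] : ℂ) =
      -((2 + (a : ℂ) ^ 3) / (2 * (a : ℂ) ^ 2 * b)) * riemannZeta 3
      + ((Real.pi / (2 * b) * ∑' n : ℕ, Real.cot (Real.pi * n / a) / (n : ℝ) ^ 2 : ℝ) : ℂ) := by
  rw [multipleMahlerMeasure_X_pow_sub_one, integral_logChord_mul_sq ha hb hab,
    ← ofReal_zetaThree]
  push_cast
  rfl

open Polynomial in
theorem corollary4p4 :
    (∀ a b : ℕ, 0 < a → 0 < b → a.Coprime b →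
      MultipleMahlerIntegrable ![X ^ a - 1, X ^ b - 1, X ^ b - 1] ∧
      Summable (fun h : {h : ℕ // 1 ≤ h ∧ ¬ a ∣ h} =>
        Real.cot (Real.pi * ((h : ℕ) : ℝ) / a) / ((h : ℕ) : ℝ) ^ 2) ∧
      (multipleMahlerMeasure ![X ^ a - 1, X ^ b - 1, X ^ b - 1] : ℂ) =
        -((2 + (a : ℂ) ^ 3) / (2 * (a : ℂ) ^ 2 * b)) * riemannZeta 3
        + ((Real.pi / (2 * b) *
            ∑' h : {h : ℕ // 1 ≤ h ∧ ¬ a ∣ h},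
              Real.cot (Real.pi * ((h : ℕ) : ℝ) / a) / ((h : ℕ) : ℝ) ^ 2 : ℝ) : ℂ)) ∧
    (∀ d : ℕ, Odd d →
      MultipleMahlerIntegrable ![X - 1, X ^ 4 - 1, X ^ (2 * d) - 1] ∧
      Summable (fun h : {h : ℕ // 1 ≤ h ∧ ¬ d ∣ 2 * h} =>
        Real.cot (Real.pi * (2 * ((h : ℕ) : ℝ)) / d) / ((h : ℕ) : ℝ) ^ 2) ∧
      Summable (fun h : {h : ℕ // 1 ≤ h ∧ ¬ d ∣ h} =>
        Real.cot (Real.pi * (((d : ℝ) + 1) * ((h : ℕ) : ℝ)) / (2 * d)) / ((h : ℕ) : ℝ) ^ 2) ∧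
      (multipleMahlerMeasure ![X - 1, X ^ 4 - 1, X ^ (2 * d) - 1] : ℂ) =
        -((9 + (d : ℂ) ^ 3) / (16 * (d : ℂ) ^ 2)) * riemannZeta 3
        + ((Real.pi / 16 *
            ∑' h : {h : ℕ // 1 ≤ h ∧ ¬ d ∣ 2 * h},
              Real.cot (Real.pi * (2 * ((h : ℕ) : ℝ)) / d) / ((h : ℕ) : ℝ) ^ 2 : ℝ) : ℂ)
        + ((Real.pi / 8 *
            ∑' h : {h : ℕ // 1 ≤ h ∧ ¬ d ∣ h},
              Real.cot (Real.pi * (((d : ℝ) + 1) * ((h : ℕ) : ℝ)) / (2 * d))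
                / ((h : ℕ) : ℝ) ^ 2 : ℝ) : ℂ)) ∧
    (∀ b : ℕ, 0 < b →
      (multipleMahlerMeasure ![X - 1, X ^ b - 1, X ^ b - 1] : ℂ) =
        -(3 / (2 * (b : ℂ))) * riemannZeta 3) ∧
    (∀ b : ℕ, 0 < b → Nat.Coprime 2 b →
      (multipleMahlerMeasure ![X ^ 2 - 1, X ^ b - 1, X ^ b - 1] : ℂ) =
        -(5 / (4 * (b : ℂ))) * riemannZeta 3) ∧
    (∀ b : ℕ, 0 < b → Nat.Coprime 3 b →
      (multipleMahlerMeasure ![X ^ 3 - 1, X ^ b - 1, X ^ b - 1] : ℂ) =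
        -(29 / (18 * (b : ℂ))) * riemannZeta 3
        + ((Real.pi / (2 * Real.sqrt 3 * b) : ℝ) : ℂ) *
            LSeries (fun n : ℕ => chiNegThree (n : ZMod 3)) 2) ∧
    (∀ b : ℕ, 0 < b → Nat.Coprime 4 b →
      (multipleMahlerMeasure ![X ^ 4 - 1, X ^ b - 1, X ^ b - 1] : ℂ) =
        -(33 / (16 * (b : ℂ))) * riemannZeta 3
        + ((Real.pi / (2 * b) : ℝ) : ℂ) *
            LSeries (fun n : ℕ => chiNegFour (n : ZMod 4)) 2) := by
  refine ⟨fun a b ha hb hab => ⟨multipleMahlerIntegrable_X_pow_sub_one ha hb hb, ?_, ?_⟩,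
    fun d hd => ?_, fun b hb => ?_, fun b hb hab => ?_, fun b hb hab => ?_, fun b hb hab => ?_⟩
  · have h := summable_cot_div_sq 1 ha
    simp only [Nat.cast_one, one_mul] at h
    exact h.subtype {h : ℕ | 1 ≤ h ∧ ¬ a ∣ h}
  · rw [multipleMahlerMeasure_pow_sub_one_sq ha hb hab]
    rw [← tsum_subtype_eq_of_support_subset
      (cot_div_sq_eq_zero (P := fun n => a ∣ n) fun n => exists_pi_mul_div_eq_of_dvd)]
    rfl
  · have hd1 : 0 < d := hd.pos
    have hd0 : (d : ℝ) ≠ 0 := by positivity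
    -- Write X as X^1, so that X − 1 fits the general shape X^p − 1.
    rw [← pow_one (X : ℂ[X]), ← pow_mul, ← pow_mul, one_mul, one_mul]
    refine ⟨multipleMahlerIntegrable_X_pow_sub_one one_pos four_pos (by positivity), ?_, ?_, ?_⟩
    · have h := summable_cot_div_sq 2 hd1
      push_cast at h
      exact h.subtype {h : ℕ | 1 ≤ h ∧ ¬ d ∣ 2 * h}
    · have h := summable_cot_div_sq (d + 1) (q := 2 * d) (by positivity)
      push_cast at h
      exact h.subtype {h : ℕ | 1 ≤ h ∧ ¬ d ∣ h}
    · have s1 := tsum_subtype_eq_of_support_subset (cot_div_sq_eq_zero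
        (x := fun n : ℕ => Real.pi * (2 * (n : ℝ)) / d) (P := fun n => d ∣ 2 * n) fun n hn => by
          have := exists_pi_mul_div_eq_of_dvd hn
          push_cast at this
          exact this)
      have s2 := tsum_subtype_eq_of_support_subset (cot_div_sq_eq_zero
        (x := fun n : ℕ => Real.pi * (((d : ℝ) + 1) * (n : ℝ)) / (2 * d)) (P := fun n => d ∣ n)
        fun n hn => by
          -- As d + 1 is even, d ∣ n gives 2d ∣ (d + 1)n, which puts the argument at a multiple of
          -- π.
          have h2 : 2 ∣ d + 1 := (hd.add_odd odd_one).two_dvd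
          have := exists_pi_mul_div_eq_of_dvd (mul_dvd_mul h2 hn)
          push_cast at this
          exact this)
      have h := integral_logChord_one_four hd
      rw [← s1, ← s2] at h
      rw [multipleMahlerMeasure_X_pow_sub_one]
      simp only [Nat.cast_one, one_mul, Nat.cast_ofNat (n := 4)]
      rw [h, ← ofReal_zetaThree]
      push_cast
      rfl
  · have h := multipleMahlerMeasure_pow_sub_one_sq one_pos hb (Nat.coprime_one_left b)
    have hz : ∀ n : ℕ, Real.cot (Real.pi * n) = 0 := Real.cot_pi_mul_natCast
    simp only [Nat.cast_one, div_one, hz, zero_div, tsum_zero, mul_zero, pow_one,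
      Complex.ofReal_zero, add_zero] at h
    rw [h]
    norm_num
  · have h := multipleMahlerMeasure_pow_sub_one_sq two_pos hb hab
    have hz : ∀ n : ℕ, Real.cot (Real.pi * n / (2 : ℕ)) = 0 := fun n => by
      rw [← Real.cot_nat_mul_pi_div_two n]
      congr 1
      push_cast
      ring
    simp only [hz, zero_div, tsum_zero, mul_zero, Complex.ofReal_zero, add_zero] at h
    rw [h]
    have hb0 : (b : ℂ) ≠ 0 := by exact_mod_cast hb.ne'
    push_cast
    field_simp
    ring
  · have hs : Real.sqrt 3 ≠ 0 := by positivity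
    have hb0 : (b : ℂ) ≠ 0 := by exact_mod_cast hb.ne'
    have e : ∑' n : ℕ, Real.cot (Real.pi * n / (3 : ℕ)) / (n : ℝ) ^ 2 =
        (Real.sqrt 3)⁻¹ * ∑' n : ℕ, Real.sqrt 3 * Real.cot (Real.pi * n / 3) / (n : ℝ) ^ 2 := by
      rw [← tsum_mul_left]
      refine tsum_congr fun n => ?_
      push_cast
      field_simp
    rw [multipleMahlerMeasure_pow_sub_one_sq three_pos hb hab, e,
      ← tsum_eq_LSeries chiNegThree _ cot_eq_chiNegThree]
    push_cast
    field_simp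
    ring
  · have hb0 : (b : ℂ) ≠ 0 := by exact_mod_cast hb.ne'
    rw [multipleMahlerMeasure_pow_sub_one_sq four_pos hb hab,
      ← tsum_eq_LSeries chiNegFour _ cot_eq_chiNegFour]
    push_cast
    field_simp
    ring
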